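/- Let $a>0$. **(i)** The Gaussian $\widetilde{\mathcal N}(t)=e^{-at^2/2}$ is real analytic on $\mathbb R$ and extends to an entire function. For every $E\in\mathbb R$ its Fourier transform converges absolutely and is a positive Gaussian, $$\frac1{2\pi}\int_{\mathbb R}\widetilde{\mathcal N}(t)\,e^{iEt}\,dt=\mathcal N(E):=\frac{1}{\sqrt{2\pi a}}\,e^{-E^2/(2a)}>0 .$$ Moreover $\mathcal N(E)\,dE$ is a probability measure, and $\int \mathcal N(E)e^{-iEt}\,dE=\widetilde{\mathcal N}(t)$ for all $t$. **(ii)** There are Hermitian $D\times D$ matrices (Hamiltonians) $H_D$, one for every $D$, with energy levels $E_1,\dots,E_D$, time evolution $U_D(t)=e^{-iH_Dt}$ and normalized density of states $\mathcal N_D=\frac1D\sum_j\delta_{E_j}$, such that the following hold. (a) The entries of $U_D(t)$ and the function $\widetilde{\mathcal N}_D(t)=\int e^{-iEt}\,d\mathcal N_D(E)$ are analytic in $t\in\mathbb R$. In the limit $D\to\infty$ the function $\widetilde{\mathcal N}_D$ becomes the Gaussian $\widetilde{\mathcal N}$, to leading order and uniformly over early times: whenever $e^{a t_D^2}\log D=o(D)$,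 $$\sup_{|t|\le t_D}\left|\widetilde{\mathcal N}_D(t)/\widetilde{\mathcal N}(t)-1\right|\longrightarrow 0\qquad(D\to\infty).$$ (b) Haar-almost all subsystems scramble by any time $t_s=\omega(\sqrt{\log D_S})$ and remain scrambled. Precisely, let $D_S$ and $D_E$ be sequences of dimensions of a subsystem and of the rest of the system, with $D=D_SD_E$, $D_E\to\infty$ and $\log D=o(D_E)$ (for example $D_S\le D^{1-\varepsilon}$, $D\to\infty$). Let $t_s$ and $T$ be sequences of times with $t_s/\sqrt{\log D_S}\to\infty$ and $\log T=o(D_E)$. For a unitary $V\in U(D)$, let $\Pi_k=V(|k\rangle\langle k|\otimes 1_{D_E})V^\dagger$, $1\le k\le D_S$, be the projectors onto the basis states of the subsystem given by $V$ (identifying $\mathbb C^D=\mathbb C^{D_S}\otimes\mathbb C^{D_E}$), and let $\Pi_k(t)=U_D(t)\Pi_kU_D(t)^\dagger$. Then for every $\delta>0$ the Haar probability of the set of all $V\in U(D)$ with $$\left|\frac1{D_E}\operatorname{Tr}[\Pi_k(t)\Pi_\ell]-\frac1{D_S}\right|\le\frac{\delta}{D_S}\qquad\text{for all } k,\ell\le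 D_S \text{ and all } t\in[t_s,T]$$ tends to $1$. -/

import Mathlib

open MeasureTheory Filter Topology
open scoped Matrix Kronecker ENNReal

/-- The density of states per level of a Hermitian matrix: `D⁻¹ ∑ⱼ δ_{Eⱼ}`, where the `Eⱼ` are
its `D` energy levels (with multiplicity). -/
noncomputable def densityOfStates {D : ℕ} {H : Matrix (Fin D) (Fin D) ℂ} (hH : H.IsHermitian) :
    Measure ℝ :=
  (D : ℝ≥0∞)⁻¹ • ∑ j, Measure.dirac (hH.eigenvalues j)

/-- The Fourier transform `t ↦ ∫ e^{-iEt} dν(E)` of a density of states `ν`. -/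
noncomputable def dosTransform (ν : Measure ℝ) (t : ℝ) : ℂ :=
  ∫ E, Complex.exp (-(Complex.I * E * t)) ∂ν

/-- The normalized Gaussian density of states `E ↦ (2πa)^{-1/2} e^{-E²/(2a)}`. -/
noncomputable def gaussianDensity (a E : ℝ) : ℝ :=
  (Real.sqrt (2 * Real.pi * a))⁻¹ * Real.exp (-E ^ 2 / (2 * a))

/-- The Hamiltonian time evolution operator `U(t) = e^{-iHt}`. -/
noncomputable def evolution {D : ℕ} (H : Matrix (Fin D) (Fin D) ℂ) (t : ℝ) :
    Matrix (Fin D) (Fin D) ℂ :=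
  NormedSpace.exp ((-(Complex.I * t)) • H)

/-- A unitary `V` presents `ℂ^{dS * dE}` as a tensor product `ℂ^{dS} ⊗ ℂ^{dE}`, with a
`dS`-dimensional subsystem and an orthonormal basis of it. This is the corresponding projector
`Π_k = V (|k⟩⟨k| ⊗ 1) V†` onto the `k`-th basis state of the subsystem. -/
noncomputable def subsystemProjector {dS dE : ℕ}
    (V : Matrix.unitaryGroup (Fin (dS * dE)) ℂ) (k : Fin dS) :
    Matrix (Fin (dS * dE)) (Fin (dS * dE)) ℂ :=
  (V : Matrix (Fin (dS * dE)) (Fin (dS * dE)) ℂ) *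
    ((Matrix.single k k (1 : ℂ)) ⊗ₖ (1 : Matrix (Fin dE) (Fin dE) ℂ)).reindex
      finProdFinEquiv finProdFinEquiv *
    (V : Matrix (Fin (dS * dE)) (Fin (dS * dE)) ℂ)ᴴ

/-- The overlap `dE⁻¹ Tr[Π_k(t) Π_l]`, with `Π_k(t) = U(t) Π_k U(t)†`, of the basis state `k` of
the subsystem evolved for a time `t` with the basis state `l`. -/
noncomputable def subsystemOverlap {dS dE : ℕ}
    (H : Matrix (Fin (dS * dE)) (Fin (dS * dE)) ℂ)
    (V : Matrix.unitaryGroup (Fin (dS * dE)) ℂ) (t : ℝ) (k l : Fin dS) : ℂ :=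
  (dE : ℂ)⁻¹ * (evolution H t * subsystemProjector V k * (evolution H t)ᴴ *
    subsystemProjector V l).trace

/-- The subsystem (with basis) given by `V` is scrambled at time `t` with relative error `δ`:
all the overlaps `dE⁻¹ Tr[Π_k(t) Π_l]` equal `1 / dS` up to an error of at most `δ / dS`. -/
def IsScrambledAt {dS dE : ℕ} (H : Matrix (Fin (dS * dE)) (Fin (dS * dE)) ℂ)
    (V : Matrix.unitaryGroup (Fin (dS * dE)) ℂ) (t δ : ℝ) : Prop :=
  ∀ k l : Fin dS, ‖subsystemOverlap H V t k l - (dS : ℂ)⁻¹‖ ≤ δ / dS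

instance unitaryGroup_compactSpace (D : ℕ) : CompactSpace (Matrix.unitaryGroup (Fin D) ℂ) := by
  have hc : IsClosed (Matrix.unitaryGroup (Fin D) ℂ : Set (Matrix (Fin D) (Fin D) ℂ)) :=
    isClosed_unitary
  have hK : IsCompact (Set.pi Set.univ fun _ : Fin D => Set.pi Set.univ fun _ : Fin D =>
      Metric.closedBall (0 : ℂ) 1) :=
    isCompact_univ_pi fun _ => isCompact_univ_pi fun _ => isCompact_closedBall _ _
  refine isCompact_iff_compactSpace.mp (hK.of_isClosed_subset hc ?_)
  intro U hU i _ j _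
  simpa using entry_norm_bound_of_unitary hU i j

noncomputable instance unitaryGroup_measurableSpace (D : ℕ) :
    MeasurableSpace (Matrix.unitaryGroup (Fin D) ℂ) :=
  borel _

instance unitaryGroup_borelSpace (D : ℕ) : BorelSpace (Matrix.unitaryGroup (Fin D) ℂ) :=
  ⟨rfl⟩

/-- The Haar probability measure on the unitary group `U(D)`. -/
noncomputable def haarUnitary (D : ℕ) : Measure (Matrix.unitaryGroup (Fin D) ℂ) :=
  Measure.haarMeasure ⊤

/-! Part (i) is the classical Gaussian integral. The rest is a double application of the
probabilistic method: random levels, then a random subsystem.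

Levels. Draw the `D` energies independently from the Gaussian density and let the Hamiltonian be
diagonal. At a fixed time the transform is an empirical mean of `D` unimodular variables, so
Hoeffding's inequality controls its deviation from `e^{-at²/2}`. A union bound over the infinite
grid `m / D`, together with a Lipschitz estimate in time, yields one choice of levels with error
`O(√(log(D + |t| + 2) / D))` for all times at once (`exists_levels`). While `e^{at²} log D = o(D)`
this error is small relative to the Gaussian, which is the early-time statement. Once `t = ω(√(log
dS))` the Gaussian is `o(dS^{-1/2})`, and as long as `log t = o(dE)` so is the error.

Subsystems. For the phases `u` at a fixed time put `M = V† diag(u) V`. The overlaps are normalized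
sums of `|M j i|²` over blocks of size `dE × dE`, so it suffices that each column of `M` gives every
block a share close to `1 / dS`. The diagonal entry `M i i` is an average of the phases with weights
`|V m i|²`; it concentrates near `tr diag(u) / D`, which is small by the choice of levels
(`haarUnitary_diag_le`). The rest of the column is uniform in direction: replacing `V` by `V W⁻¹`,
with `W` fixing the `i`-th basis vector, applies `W` to the column and preserves Haar measure
(`haarUnitary_block_le`). In both cases the Haar probability of a cone is bounded by a Gaussian one
(`haarMeasure_orbit_le_complexGaussian`), and a Chernoff bound for weighted sums of squares
finishes.

Failure at one time has probability at most a polynomial in `D` times `e^{-c dE}`. A time grid of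
mesh of order `D^{-2}` adds a factor polynomial in `D` and linear in `T`, and `log D`, `log T =
o(dE)` make the total vanish. -/

/-! ### The Gaussian and its Fourier transform -/

theorem analyticOnNhd_gaussian (a : ℝ) :
    AnalyticOnNhd ℝ (fun t : ℝ => Real.exp (-a * t ^ 2 / 2)) Set.univ := by
  intro t _
  exact AnalyticAt.rexp (by fun_prop (disch := norm_num))

theorem analyticOnNhd_cexp_gaussian (a : ℝ) :
    AnalyticOnNhd ℂ (fun z : ℂ => Complex.exp (-a * z ^ 2 / 2)) Set.univ := by
  intro t _
  exact AnalyticAt.cexp (by fun_prop (disch := norm_num))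

theorem gaussianDensity_pos {a : ℝ} (ha : 0 < a) (E : ℝ) : 0 < gaussianDensity a E := by
  unfold gaussianDensity
  positivity

theorem integrable_gaussian_mul_cexp {a : ℝ} (ha : 0 < a) (E : ℝ) :
    Integrable (fun t : ℝ =>
      (Real.exp (-a * t ^ 2 / 2) : ℂ) * Complex.exp (Complex.I * E * t)) := by
  have h := (integrable_exp_neg_mul_sq (half_pos ha)).ofReal (𝕜 := ℂ)
  refine (h.bdd_mul (c := 1) (f := fun t : ℝ => Complex.exp (Complex.I * E * t))
    (by fun_prop) (ae_of_all _ fun t => ?_)).congr (ae_of_all _ fun t => ?_)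
  · rw [Complex.norm_exp]
    simp
  · simp only [mul_comm]
    congr 3
    norm_num
    ring

theorem gaussian_fourierIntegral {a : ℝ} (ha : 0 < a) (E : ℝ) :
    ((2 * Real.pi : ℝ) : ℂ)⁻¹ * ∫ t : ℝ,
      (Real.exp (-a * t ^ 2 / 2) : ℂ) * Complex.exp (Complex.I * E * t) =
        (gaussianDensity a E : ℂ) := by
  have h := fourierIntegral_gaussian (b := ((a / 2 : ℝ) : ℂ)) (by simpa using ha) (E : ℂ)
  have e : ∀ t : ℝ, (Real.exp (-a * t ^ 2 / 2) : ℂ) * Complex.exp (Complex.I * E * t) =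
      Complex.exp (Complex.I * E * t) * Complex.exp (-((a / 2 : ℝ) : ℂ) * (t : ℂ) ^ 2) := by
    intro t
    rw [mul_comm]
    congr 1
    push_cast
    congr 1
    ring
  simp_rw [e]
  rw [h]
  have h1 : ((Real.pi : ℂ) / ((a / 2 : ℝ) : ℂ)) ^ (1 / 2 : ℂ) =
      ((Real.sqrt (2 * Real.pi / a) : ℝ) : ℂ) := by
    rw [Real.sqrt_eq_rpow, Complex.ofReal_cpow (by positivity)]
    push_cast
    congr 1
    field_simp
  have h2 : Complex.exp (-(E : ℂ) ^ 2 / (4 * ((a / 2 : ℝ) : ℂ))) =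
      ((Real.exp (-E ^ 2 / (2 * a)) : ℝ) : ℂ) := by
    push_cast
    congr 2
    ring
  rw [h1, h2, gaussianDensity]
  rw [← Complex.ofReal_inv, ← Complex.ofReal_mul, ← Complex.ofReal_mul, ← mul_assoc]
  congr 2
  have h3 : Real.sqrt (2 * Real.pi / a) * Real.sqrt (2 * Real.pi * a) = 2 * Real.pi := by
    rw [← Real.sqrt_mul (by positivity)]
    rw [show 2 * Real.pi / a * (2 * Real.pi * a) = (2 * Real.pi) ^ 2 by field_simp]
    exact Real.sqrt_sq (by positivity)
  have h4 : Real.sqrt (2 * Real.pi * a) ≠ 0 := (Real.sqrt_pos.2 (by positivity)).ne'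
  field_simp
  linarith

theorem withDensity_gaussianDensity {a : ℝ} (ha : 0 < a) :
    (volume.withDensity fun E => ENNReal.ofReal (gaussianDensity a E)) =
      ProbabilityTheory.gaussianReal 0 a.toNNReal := by
  rw [ProbabilityTheory.gaussianReal_of_var_ne_zero _ (Real.toNNReal_pos.2 ha).ne']
  congr 1
  ext E
  simp [gaussianDensity, ProbabilityTheory.gaussianPDF, ProbabilityTheory.gaussianPDFReal, ha.le]

theorem dosTransform_gaussianReal {a : ℝ} (ha : 0 ≤ a) (t : ℝ) :
    dosTransform (ProbabilityTheory.gaussianReal 0 a.toNNReal) t =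
      (Real.exp (-a * t ^ 2 / 2) : ℂ) := by
  have h := ProbabilityTheory.charFun_gaussianReal (μ := 0) (v := a.toNNReal) (-t)
  rw [charFun_apply_real] at h
  unfold dosTransform
  rw [show (fun E : ℝ => Complex.exp (-(Complex.I * E * t))) =
    fun E : ℝ => Complex.exp (((-t : ℝ) : ℂ) * E * Complex.I) by
      ext E
      congr 1
      push_cast
      ring, h]
  rw [Complex.ofReal_exp, Real.coe_toNNReal a ha]
  congr 1
  push_cast
  ring

/-! ### Gaussian vectors: unitary invariance and concentration -/

/-- The standard Gaussian measure on `ℂ^D`; each entry has independent real and imaginary parts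
of variance one. -/
noncomputable def complexGaussian (D : ℕ) : Measure (Fin D → ℂ) :=
  (ProbabilityTheory.stdGaussian (PiLp 2 fun _ : Fin D => ℂ)).map WithLp.ofLp

instance isProbabilityMeasure_complexGaussian (D : ℕ) :
    IsProbabilityMeasure (complexGaussian D) :=
  Measure.isProbabilityMeasure_map (by fun_prop)

theorem sum_normSq_eq_star_dotProduct {D : ℕ} (y : Fin D → ℂ) :
    ((∑ j, ‖y j‖ ^ 2 : ℝ) : ℂ) = star y ⬝ᵥ y := by
  simp only [dotProduct, Complex.ofReal_sum, Pi.star_apply]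
  refine Finset.sum_congr rfl fun j _ => ?_
  rw [Complex.star_def, ← Complex.normSq_eq_conj_mul_self, Complex.normSq_eq_norm_sq]

theorem sum_normSq_mulVec_of_unitary {D : ℕ} (W : Matrix.unitaryGroup (Fin D) ℂ)
    (x : Fin D → ℂ) :
    ∑ j, ‖((W : Matrix (Fin D) (Fin D) ℂ) *ᵥ x) j‖ ^ 2 = ∑ j, ‖x j‖ ^ 2 := by
  have h : star ((W : Matrix (Fin D) (Fin D) ℂ) *ᵥ x) ⬝ᵥ ((W : Matrix (Fin D) (Fin D) ℂ) *ᵥ x) =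
      star x ⬝ᵥ x := by
    rw [Matrix.star_mulVec, ← Matrix.dotProduct_mulVec, Matrix.mulVec_mulVec,
      ← Matrix.star_eq_conjTranspose, Matrix.UnitaryGroup.star_mul_self, Matrix.one_mulVec]
  exact_mod_cast (sum_normSq_eq_star_dotProduct _).trans
    (h.trans (sum_normSq_eq_star_dotProduct x).symm)

theorem map_mulVec_complexGaussian {D : ℕ} (W : Matrix.unitaryGroup (Fin D) ℂ) :
    (complexGaussian D).map (fun g => (W : Matrix (Fin D) (Fin D) ℂ) *ᵥ g) =
      complexGaussian D := by
  let e : (PiLp 2 fun _ : Fin D => ℂ) ≃ₗ[ℝ] (PiLp 2 fun _ : Fin D => ℂ) :=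
    { toFun := fun g => WithLp.toLp 2 ((W : Matrix (Fin D) (Fin D) ℂ) *ᵥ WithLp.ofLp g)
      invFun := fun g => WithLp.toLp 2 (star (W : Matrix (Fin D) (Fin D) ℂ) *ᵥ WithLp.ofLp g)
      map_add' := fun x y => by ext; simp [Matrix.mulVec_add]
      map_smul' := fun c x => by ext; simp [Matrix.mulVec_smul]
      left_inv := fun x => by simp [Matrix.mulVec_mulVec]
      right_inv := fun x => by simp [Matrix.mulVec_mulVec] }
  let f : (PiLp 2 fun _ : Fin D => ℂ) ≃ₗᵢ[ℝ] (PiLp 2 fun _ : Fin D => ℂ) :=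
    { e with
      norm_map' := fun x => by
        rw [PiLp.norm_eq_of_L2, PiLp.norm_eq_of_L2]
        congr 1
        exact sum_normSq_mulVec_of_unitary W (WithLp.ofLp x) }
  have hf := ProbabilityTheory.stdGaussian_map f
  have hm : Measurable f := f.continuous.measurable
  conv_rhs => rw [complexGaussian, ← hf, Measure.map_map (by fun_prop) hm]
  rw [complexGaussian, Measure.map_map
    (Continuous.measurable (by fun_prop)) (by fun_prop)]
  rfl

/-- The basis `1, i` in each coordinate is orthonormal over `ℝ`. The product form lets exponential
moments factorize. -/
theorem complexGaussian_eq_map_pi (D : ℕ) :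
    complexGaussian D =
      (Measure.pi fun _ : (_ : Fin D) × Fin 2 => ProbabilityTheory.gaussianReal 0 1).map
        (fun x j => (x ⟨j, 0⟩ : ℂ) + x ⟨j, 1⟩ * Complex.I) := by
  rw [complexGaussian, ProbabilityTheory.stdGaussian_eq_map_pi_orthonormalBasis
    (Pi.orthonormalBasis fun _ : Fin D => Complex.orthonormalBasisOneI),
    Measure.map_map (by fun_prop) (by fun_prop)]
  congr 1
  ext x j
  simp [Fintype.sum_sigma, Finset.sum_add_distrib, Pi.single_apply]

/-- The integral equals `e^{-m} (1 - 2m)^{-1/2}`; its logarithm has no linear term in `m`, and for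
`|m| ≤ 1/4` the Taylor remainder is at most `4m²`. -/
theorem mgf_sq_sub_one_gaussianReal {m : ℝ} (hm : |m| ≤ 1 / 4) :
    ∫⁻ x, ENNReal.ofReal (Real.exp (m * (x ^ 2 - 1))) ∂ProbabilityTheory.gaussianReal 0 1 ≤
      ENNReal.ofReal (Real.exp (4 * m ^ 2)) := by
  obtain ⟨hm1, hm2⟩ := abs_le.1 hm
  rw [ProbabilityTheory.gaussianReal_of_var_ne_zero _ one_ne_zero,
    lintegral_withDensity_eq_lintegral_mul _ (by fun_prop) (by fun_prop)]
  have e : ∀ x : ℝ, (ProbabilityTheory.gaussianPDF 0 1 *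
      fun x => ENNReal.ofReal (Real.exp (m * (x ^ 2 - 1)))) x =
      ENNReal.ofReal ((√(2 * Real.pi))⁻¹ * Real.exp (-m) * Real.exp (-(1 / 2 - m) * x ^ 2)) := by
    intro x
    simp only [Pi.mul_apply, ProbabilityTheory.gaussianPDF, ProbabilityTheory.gaussianPDFReal]
    rw [← ENNReal.ofReal_mul (by positivity)]
    congr 1
    simp only [NNReal.coe_one, mul_one, sub_zero]
    rw [mul_assoc, mul_assoc, ← Real.exp_add, ← Real.exp_add]
    congr 2
    ring
  simp_rw [e]
  rw [← ofReal_integral_eq_lintegral_ofReal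
    ((integrable_exp_neg_mul_sq (by linarith)).const_mul _)
    (ae_of_all _ fun x => by positivity)]
  apply ENNReal.ofReal_le_ofReal
  rw [integral_const_mul, integral_gaussian]
  have hpos : 0 < 1 - 2 * m := by linarith
  have h1 : (√(2 * Real.pi))⁻¹ * Real.exp (-m) * √(Real.pi / (1 / 2 - m)) =
      Real.exp (-m) * √((1 - 2 * m)⁻¹) := by
    rw [mul_comm (√(2 * Real.pi))⁻¹, mul_assoc, ← Real.sqrt_inv, ← Real.sqrt_mul (by positivity)]
    congr 2
    have : (1 / 2 - m) ≠ 0 := by linarith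
    field_simp
  rw [h1, ← Real.log_le_log_iff (by positivity) (by positivity), Real.log_exp,
    Real.log_mul (by positivity) (by positivity), Real.log_exp, Real.log_sqrt (by positivity),
    Real.log_inv]
  have hu : |2 * m| ≤ 1 / 2 := by
    rw [abs_le]
    constructor <;> linarith
  have h2 := Real.abs_log_sub_add_sum_range_le (x := 2 * m) (by linarith) 1
  have h3 : |2 * m| ^ (1 + 1) / (1 - |2 * m|) ≤ 2 * (2 * m) ^ 2 := by
    rw [div_le_iff₀ (by linarith), sq_abs]
    nlinarith [sq_nonneg (2 * m)]
  have h4 := (abs_le.1 (h2.trans h3)).1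
  simp at h4
  nlinarith

theorem lintegral_pi_prod {ι X : Type*} [Fintype ι] [MeasurableSpace X] {μ : Measure X}
    [IsProbabilityMeasure μ] {f : ι → X → ℝ≥0∞} (hf : ∀ i, Measurable (f i)) :
    ∫⁻ x, ∏ i, f i (x i) ∂Measure.pi (fun _ : ι => μ) = ∏ i, ∫⁻ y, f i y ∂μ := by
  rw [ProbabilityTheory.lintegral_prod_eq_prod_lintegral_of_indepFun Finset.univ
    (fun i (x : ι → X) => f i (x i))
    (ProbabilityTheory.iIndepFun_pi fun i => (hf i).aemeasurable)
    (fun i => (hf i).comp (measurable_pi_apply i))]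
  exact Finset.prod_congr rfl fun i _ =>
    (measurePreserving_eval (fun _ : ι => μ) i).lintegral_comp (hf i)

/-- Chernoff's method: the exponential moment is a product over real and imaginary parts, each
bounded by `mgf_sq_sub_one_gaussianReal`. -/
theorem complexGaussian_le_of_sum_le {D : ℕ} {a : Fin D → ℝ} {M ε : ℝ} (ha : ∀ j, |a j| ≤ 1)
    (hM : ∑ j, a j ^ 2 ≤ M) (hε : 0 ≤ ε) (hε1 : ε ≤ 1) :
    complexGaussian D {g | ε * M ≤ ∑ j, a j * (‖g j‖ ^ 2 / 2 - 1)} ≤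
      ENNReal.ofReal (Real.exp (-(ε ^ 2 * M / 8))) := by
  -- This minimizes the exponent `2 l² M - l ε M`, with value `-ε² M / 8`.
  set l := ε / 4 with hl
  let F : (Fin D → ℂ) → ℝ≥0∞ := fun g =>
    ENNReal.ofReal (Real.exp (l * ∑ j, a j * (‖g j‖ ^ 2 / 2 - 1)))
  have hF : Measurable F := by fun_prop
  have hint : ∫⁻ g, F g ∂complexGaussian D ≤ ENNReal.ofReal (Real.exp (2 * l ^ 2 * M)) := by
    rw [complexGaussian_eq_map_pi, lintegral_map hF (by fun_prop)]
    have e : ∀ x : (_ : Fin D) × Fin 2 → ℝ,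
        F (fun j => (x ⟨j, 0⟩ : ℂ) + x ⟨j, 1⟩ * Complex.I) =
          ∏ p, ENNReal.ofReal (Real.exp ((l * a p.1 / 2) * (x p ^ 2 - 1))) := by
      intro x
      rw [← ENNReal.ofReal_prod_of_nonneg (fun _ _ => (Real.exp_pos _).le), ← Real.exp_sum]
      simp only [F]
      congr 2
      rw [Fintype.sum_sigma, Finset.mul_sum]
      refine Finset.sum_congr rfl fun j _ => ?_
      rw [Fin.sum_univ_two, ← Complex.normSq_eq_norm_sq, Complex.normSq_add_mul_I]
      ring
    simp_rw [e]
    rw [lintegral_pi_prod (f := fun p : (_ : Fin D) × Fin 2 => fun y : ℝ =>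
      ENNReal.ofReal (Real.exp ((l * a p.1 / 2) * (y ^ 2 - 1)))) fun p => by fun_prop]
    calc ∏ p : (_ : Fin D) × Fin 2, ∫⁻ y,
          ENNReal.ofReal (Real.exp ((l * a p.1 / 2) * (y ^ 2 - 1)))
            ∂ProbabilityTheory.gaussianReal 0 1
        ≤ ∏ p : (_ : Fin D) × Fin 2, ENNReal.ofReal (Real.exp (4 * (l * a p.1 / 2) ^ 2)) := by
          refine Finset.prod_le_prod' fun p _ => ?_
          apply mgf_sq_sub_one_gaussianReal
          rw [abs_div, abs_mul, abs_of_nonneg (by positivity), abs_of_pos (zero_lt_two' ℝ)]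
          have := mul_le_mul_of_nonneg_left (ha p.1) (show 0 ≤ l by positivity)
          linarith
      _ ≤ ENNReal.ofReal (Real.exp (2 * l ^ 2 * M)) := by
          rw [← ENNReal.ofReal_prod_of_nonneg (fun _ _ => (Real.exp_pos _).le), ← Real.exp_sum]
          apply ENNReal.ofReal_le_ofReal
          rw [Real.exp_le_exp, Fintype.sum_sigma]
          refine le_trans (le_of_eq ?_) (mul_le_mul_of_nonneg_left hM (by positivity))
          rw [Finset.mul_sum]
          refine Finset.sum_congr rfl fun j _ => ?_
          rw [Fin.sum_univ_two]
          ring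
  calc complexGaussian D {g | ε * M ≤ ∑ j, a j * (‖g j‖ ^ 2 / 2 - 1)}
      ≤ complexGaussian D {g | ENNReal.ofReal (Real.exp (l * (ε * M))) ≤ F g} := by
        refine measure_mono fun g hg => ENNReal.ofReal_le_ofReal (Real.exp_le_exp.2 ?_)
        exact mul_le_mul_of_nonneg_left hg (by positivity)
    _ ≤ (∫⁻ g, F g ∂complexGaussian D) / ENNReal.ofReal (Real.exp (l * (ε * M))) :=
        meas_ge_le_lintegral_div hF.aemeasurable (by positivity) ENNReal.ofReal_ne_top
    _ ≤ ENNReal.ofReal (Real.exp (2 * l ^ 2 * M)) / ENNReal.ofReal (Real.exp (l * (ε * M))) := by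
        gcongr
    _ = ENNReal.ofReal (Real.exp (-(ε ^ 2 * M / 8))) := by
        rw [← ENNReal.ofReal_div_of_pos (Real.exp_pos _), ← Real.exp_sub]
        congr 2
        rw [hl]
        ring

theorem complexGaussian_le_of_abs_sum_le {D : ℕ} {a : Fin D → ℝ} {M ε : ℝ} (ha : ∀ j, |a j| ≤ 1)
    (hM : ∑ j, a j ^ 2 ≤ M) (hε : 0 ≤ ε) (hε1 : ε ≤ 1) :
    complexGaussian D {g | ε * M ≤ |∑ j, a j * (‖g j‖ ^ 2 / 2 - 1)|} ≤
      2 * ENNReal.ofReal (Real.exp (-(ε ^ 2 * M / 8))) := by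
  have h1 := complexGaussian_le_of_sum_le ha hM hε hε1
  have h2 := complexGaussian_le_of_sum_le (a := fun j => -a j) (by simpa using ha)
    (by simpa using hM) hε hε1
  rw [two_mul]
  refine le_trans (measure_mono fun g hg => ?_) ((measure_union_le _ _).trans (add_le_add h1 h2))
  rcases le_abs.1 (show ε * M ≤ |∑ j, a j * (‖g j‖ ^ 2 / 2 - 1)| from hg) with h | h
  · exact Or.inl h
  · right
    simpa [neg_mul, Finset.sum_neg_distrib] using h

/-! ### Transitivity of the unitary group and invariance of Haar measure -/

open scoped ComplexOrder in
-- A complex Householder reflection `1 - c⁻¹ w w*` with `w = x - y` and `c = w* x`. Equality of the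
-- norms gives `w* w = c + c̄`, which is exactly the condition for unitarity; vectors orthogonal to
-- `x` and `y` are orthogonal to `w` and hence fixed.
theorem exists_unitary_mulVec_eq {D : ℕ} {x y : Fin D → ℂ} (h : star x ⬝ᵥ x = star y ⬝ᵥ y) :
    ∃ W : Matrix.unitaryGroup (Fin D) ℂ, (W : Matrix (Fin D) (Fin D) ℂ) *ᵥ x = y ∧
      ∀ z, star x ⬝ᵥ z = 0 → star y ⬝ᵥ z = 0 → (W : Matrix (Fin D) (Fin D) ℂ) *ᵥ z = z := by
  by_cases hxy : x = y
  · exact ⟨1, by simp [hxy], by simp⟩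
  set w := x - y with hw
  set c := star w ⬝ᵥ x with hc
  have hs : star w ⬝ᵥ w = c + star c := by
    rw [hc, ← Matrix.star_dotProduct, hw]
    simp only [star_sub, sub_dotProduct, dotProduct_sub]
    rw [h]
    ring
  have hw0 : star w ⬝ᵥ w ≠ 0 := by
    rw [Ne, dotProduct_star_self_eq_zero]
    exact sub_ne_zero.2 hxy
  have hc0 : c ≠ 0 := by
    intro h0
    rw [hs, h0] at hw0
    simp at hw0
  have hc1 : star c ≠ 0 := by simpa using hc0
  set P := Matrix.vecMulVec w (star w) with hP
  have hPP : P * P = (c + star c) • P := by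
    rw [hP, Matrix.vecMulVec_mul_vecMulVec, hs]
    ext i j
    simp [Matrix.vecMulVec_apply]
    ring
  have hPs : Pᴴ = P := by
    rw [hP, Matrix.conjTranspose_vecMulVec, star_star]
  have hPv : ∀ z, P *ᵥ z = (star w ⬝ᵥ z) • w := by
    intro z
    rw [hP, Matrix.vecMulVec_mulVec]
    ext i
    simp [mul_comm]
  refine ⟨⟨1 - c⁻¹ • P, ?_⟩, ?_, ?_⟩
  · rw [Matrix.mem_unitaryGroup_iff']
    rw [Matrix.star_eq_conjTranspose, Matrix.conjTranspose_sub, Matrix.conjTranspose_smul, hPs,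
      Matrix.conjTranspose_one, sub_mul, mul_sub, mul_sub, one_mul, one_mul, mul_one,
      smul_mul_smul_comm, hPP, smul_smul]
    have : star c⁻¹ * c⁻¹ * (c + star c) = star c⁻¹ + c⁻¹ := by
      rw [star_inv₀]
      field_simp
    rw [this, add_smul]
    abel
  · rw [Matrix.sub_mulVec, Matrix.one_mulVec, Matrix.smul_mulVec, hPv, ← hc, smul_smul,
      inv_mul_cancel₀ hc0, one_smul, hw]
    abel
  · intro z hx hy
    rw [Matrix.sub_mulVec, Matrix.one_mulVec, Matrix.smul_mulVec, hPv, hw]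
    simp [star_sub, sub_dotProduct, hx, hy]

/-- Compact groups are unimodular: the translated measure is again left invariant, hence a multiple
of Haar measure, and the total mass forces the factor to be one. -/
theorem map_mul_right_haarMeasure_top {G : Type*} [Group G] [TopologicalSpace G]
    [IsTopologicalGroup G] [CompactSpace G] [MeasurableSpace G] [BorelSpace G] (g : G) :
    (Measure.haarMeasure (⊤ : TopologicalSpace.PositiveCompacts G)).map (· * g) =
      Measure.haarMeasure ⊤ := by
  set μ := Measure.haarMeasure (⊤ : TopologicalSpace.PositiveCompacts G) with hμ
  have hm : Measurable (fun x : G => x * g) := (continuous_mul_const g).measurable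
  have h1 : μ Set.univ = 1 := Measure.haarMeasure_self
  have hl : (μ.map (· * g)).IsMulLeftInvariant := inferInstance
  have : IsProbabilityMeasure μ := ⟨h1⟩
  have : IsProbabilityMeasure (μ.map (· * g)) := Measure.isProbabilityMeasure_map hm.aemeasurable
  have h := Measure.isMulInvariant_eq_smul_of_compactSpace (μ.map (· * g)) μ
  have h2 := congrArg (fun ν => ν Set.univ) h
  simp only [measure_univ, Measure.smul_apply] at h2
  have h3 : (μ.map (· * g)).haarScalarFactor μ = 1 := by
    simpa [ENNReal.smul_def] using h2.symm
  rw [h, h3, one_smul]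

instance isProbabilityMeasure_haarMeasure_top {G : Type*} [Group G] [TopologicalSpace G]
    [IsTopologicalGroup G] [CompactSpace G] [MeasurableSpace G] [BorelSpace G] :
    IsProbabilityMeasure (Measure.haarMeasure (⊤ : TopologicalSpace.PositiveCompacts G)) :=
  ⟨Measure.haarMeasure_self⟩

instance isProbabilityMeasure_haarUnitary (D : ℕ) : IsProbabilityMeasure (haarUnitary D) :=
  isProbabilityMeasure_haarMeasure_top

instance secondCountableTopology_unitaryGroup (D : ℕ) :
    SecondCountableTopology (Matrix.unitaryGroup (Fin D) ℂ) := by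
  have : SecondCountableTopology (Matrix (Fin D) (Fin D) ℂ) :=
    inferInstanceAs (SecondCountableTopology (Fin D → Fin D → ℂ))
  exact TopologicalSpace.Subtype.secondCountableTopology _

/-! ### Comparison of Haar orbits with Gaussian vectors -/

/-- The coordinate projection of a vector onto the entries in `S`. -/
def coordProj {D : ℕ} (S : Finset (Fin D)) (x : Fin D → ℂ) : Fin D → ℂ :=
  fun j => if j ∈ S then x j else 0

/-- If a compact group of unitaries commutes with a coordinate projection and is transitive on the
spheres in its range, then its orbits there are no more likely to hit a closed cone containing
the origin than the projection of a Gaussian vector. -/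
theorem haarMeasure_orbit_le_complexGaussian {D : ℕ} {G : Type*} [Group G] [TopologicalSpace G]
    [IsTopologicalGroup G] [CompactSpace G] [MeasurableSpace G] [BorelSpace G]
    (ρ : G →* Matrix.unitaryGroup (Fin D) ℂ) (hρ : Continuous ρ) (S : Finset (Fin D))
    (hcomm : ∀ W g, (ρ W : Matrix (Fin D) (Fin D) ℂ) *ᵥ coordProj S g =
      coordProj S ((ρ W : Matrix (Fin D) (Fin D) ℂ) *ᵥ g))
    (htrans : ∀ x y, coordProj S x = x → coordProj S y = y → ∑ j, ‖x j‖ ^ 2 = ∑ j, ‖y j‖ ^ 2 →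
      ∃ W, (ρ W : Matrix (Fin D) (Fin D) ℂ) *ᵥ x = y)
    {A : Set (Fin D → ℂ)} (hA : IsClosed A) (hA0 : 0 ∈ A)
    (hAs : ∀ c : ℝ, 0 < c → ∀ y ∈ A, (c : ℂ) • y ∈ A)
    {x : Fin D → ℂ} (hx : x ≠ 0) (hxS : coordProj S x = x) :
    Measure.haarMeasure (⊤ : TopologicalSpace.PositiveCompacts G)
        {W | (ρ W : Matrix (Fin D) (Fin D) ℂ) *ᵥ x ∈ A} ≤
      complexGaussian D {g | coordProj S g ∈ A} := by
  set μ := Measure.haarMeasure (⊤ : TopologicalSpace.PositiveCompacts G) with hμ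
  have hc2 : Continuous fun p : G × (Fin D → ℂ) =>
      (ρ p.1 : Matrix (Fin D) (Fin D) ℂ) *ᵥ p.2 := by
    have : Continuous fun p : G × (Fin D → ℂ) => (ρ p.1 : Matrix (Fin D) (Fin D) ℂ) :=
      continuous_subtype_val.comp (hρ.comp continuous_fst)
    exact this.matrix_mulVec continuous_snd
  have hproj : Continuous (coordProj S : (Fin D → ℂ) → _) := by
    refine continuous_pi fun j => ?_
    unfold coordProj
    split_ifs <;> fun_prop
  have hsq : ∀ (c : ℝ) (y : Fin D → ℂ), ∑ j, ‖((c : ℂ) • y) j‖ ^ 2 = c ^ 2 * ∑ j, ‖y j‖ ^ 2 := by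
    intro c y
    rw [Finset.mul_sum]
    refine Finset.sum_congr rfl fun j _ => ?_
    simp [mul_pow]
  have hpos : ∀ y : Fin D → ℂ, y ≠ 0 → 0 < ∑ j, ‖y j‖ ^ 2 := by
    intro y hy
    obtain ⟨j, hj⟩ := Function.ne_iff.1 hy
    exact Finset.sum_pos' (fun _ _ => by positivity)
      ⟨j, Finset.mem_univ _, by have := norm_pos_iff.2 hj; positivity⟩
  -- Transitivity carries a positive multiple of the projected `g` to `x`. Right invariance absorbs
  -- the group element and the cone property absorbs the multiple; a vanishing projection is covered
  -- by `0 ∈ A`.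
  have hle : ∀ g : Fin D → ℂ, μ {W | (ρ W : Matrix (Fin D) (Fin D) ℂ) *ᵥ x ∈ A} ≤
      μ {W | (ρ W : Matrix (Fin D) (Fin D) ℂ) *ᵥ coordProj S g ∈ A} := by
    intro g
    by_cases hg : coordProj S g = 0
    · refine measure_mono fun W _ => ?_
      simpa [hg] using hA0
    set y := coordProj S g with hy
    have hyS : coordProj S y = y := by
      ext j
      simp only [hy, coordProj]
      split_ifs <;> rfl
    set c : ℝ := √((∑ j, ‖x j‖ ^ 2) / ∑ j, ‖y j‖ ^ 2) with hc
    have hcpos : 0 < c := Real.sqrt_pos.2 (div_pos (hpos x hx) (hpos y hg))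
    obtain ⟨V, hV⟩ := htrans ((c : ℂ) • y) x (by
        ext j
        have := congrFun hyS j
        simp only [coordProj] at this ⊢
        split_ifs with hj
        · rfl
        · rw [if_neg hj] at this
          simp [← this]) hxS (by
      rw [hsq, hc, Real.sq_sqrt (div_pos (hpos x hx) (hpos y hg)).le,
        div_mul_cancel₀ _ (hpos y hg).ne'])
    have e : {W | (ρ W : Matrix (Fin D) (Fin D) ℂ) *ᵥ x ∈ A} =
        (· * V) ⁻¹' {W | (ρ W : Matrix (Fin D) (Fin D) ℂ) *ᵥ ((c : ℂ) • y) ∈ A} := by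
      ext W
      simp only [Set.mem_ofPred_eq, Set.mem_preimage, map_mul, Submonoid.coe_mul,
        ← Matrix.mulVec_mulVec, hV]
    have hy1 : Continuous fun W => (ρ W : Matrix (Fin D) (Fin D) ℂ) *ᵥ ((c : ℂ) • y) :=
      hc2.comp (Continuous.prodMk_left _)
    have hy2 : MeasurableSet {W | (ρ W : Matrix (Fin D) (Fin D) ℂ) *ᵥ ((c : ℂ) • y) ∈ A} :=
      (hA.preimage hy1).measurableSet
    rw [e, ← Measure.map_apply (continuous_mul_const V).measurable hy2,
      map_mul_right_haarMeasure_top]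
    refine measure_mono fun W hW => ?_
    have := hAs c⁻¹ (inv_pos.2 hcpos) _ hW
    rwa [Matrix.mulVec_smul, smul_smul, ← Complex.ofReal_mul, inv_mul_cancel₀ hcpos.ne',
      Complex.ofReal_one, one_smul] at this
  have hmeas : MeasurableSet {p : G × (Fin D → ℂ) |
      (ρ p.1 : Matrix (Fin D) (Fin D) ℂ) *ᵥ coordProj S p.2 ∈ A} := by
    refine IsClosed.measurableSet (hA.preimage ?_)
    exact hc2.comp (continuous_fst.prodMk (hproj.comp continuous_snd))
  have hγ : ∀ W : G, complexGaussian D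
      {g | (ρ W : Matrix (Fin D) (Fin D) ℂ) *ᵥ coordProj S g ∈ A} =
      complexGaussian D {g | coordProj S g ∈ A} := by
    intro W
    have hm : MeasurableSet {g : Fin D → ℂ | coordProj S g ∈ A} :=
      (hA.preimage hproj).measurableSet
    conv_rhs => rw [← map_mulVec_complexGaussian (ρ W)]
    have hW : Continuous fun g => (ρ W : Matrix (Fin D) (Fin D) ℂ) *ᵥ g :=
      hc2.comp (Continuous.prodMk_right W)
    rw [Measure.map_apply hW.measurable hm]
    simp only [Set.preimage_ofPred_eq, hcomm]
  -- Average the bound over a Gaussian `g` and exchange the integrals: for each fixed `W`, unitary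
  -- invariance of the Gaussian removes `W`.
  calc μ {W | (ρ W : Matrix (Fin D) (Fin D) ℂ) *ᵥ x ∈ A}
      = ∫⁻ _, μ {W | (ρ W : Matrix (Fin D) (Fin D) ℂ) *ᵥ x ∈ A} ∂complexGaussian D := by simp
    _ ≤ ∫⁻ g, μ {W | (ρ W : Matrix (Fin D) (Fin D) ℂ) *ᵥ coordProj S g ∈ A} ∂complexGaussian D :=
        lintegral_mono hle
    _ = (μ.prod (complexGaussian D)) {p : G × (Fin D → ℂ) |
          (ρ p.1 : Matrix (Fin D) (Fin D) ℂ) *ᵥ coordProj S p.2 ∈ A} := by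
        rw [Measure.prod_apply_symm hmeas]
        rfl
    _ = ∫⁻ W, complexGaussian D
          {g | (ρ W : Matrix (Fin D) (Fin D) ℂ) *ᵥ coordProj S g ∈ A} ∂μ := by
        rw [Measure.prod_apply hmeas]
        rfl
    _ = complexGaussian D {g | coordProj S g ∈ A} := by
        simp [hγ]

/-- A column of a Haar unitary is no more likely to hit a closed cone than a Gaussian vector. -/
theorem haarUnitary_column_le_complexGaussian {D : ℕ} (i : Fin D) {A : Set (Fin D → ℂ)}
    (hA : IsClosed A) (hA0 : 0 ∈ A) (hAs : ∀ c : ℝ, 0 < c → ∀ y ∈ A, (c : ℂ) • y ∈ A) :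
    haarUnitary D {V | (V : Matrix (Fin D) (Fin D) ℂ) *ᵥ Pi.single i 1 ∈ A} ≤
      complexGaussian D A := by
  have huniv : ∀ g : Fin D → ℂ, coordProj Finset.univ g = g := by
    intro g
    ext j
    simp [coordProj]
  have h := haarMeasure_orbit_le_complexGaussian
    (MonoidHom.id (Matrix.unitaryGroup (Fin D) ℂ)) continuous_id Finset.univ
    (fun W g => by rw [huniv, huniv])
    (fun x y _ _ hxy => by
      obtain ⟨W, hW, -⟩ := exists_unitary_mulVec_eq (x := x) (y := y) (by
        rw [← sum_normSq_eq_star_dotProduct, hxy, sum_normSq_eq_star_dotProduct])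
      exact ⟨W, hW⟩) hA hA0 hAs (x := Pi.single i 1) (by simp) (huniv _)
  simpa only [huniv, MonoidHom.id_apply, Set.ofPred_mem_eq, haarUnitary] using h

/-- The stabilizer in `U(D)` of a standard basis vector. -/
def basisStabilizer {D : ℕ} (i : Fin D) : Subgroup (Matrix.unitaryGroup (Fin D) ℂ) where
  carrier := {W | (W : Matrix (Fin D) (Fin D) ℂ) *ᵥ Pi.single i 1 = Pi.single i 1}
  one_mem' := Matrix.one_mulVec _
  mul_mem' := fun {V W} hV hW => by
    simp only [Set.mem_ofPred_eq] at hV hW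
    simp only [Set.mem_ofPred_eq, Submonoid.coe_mul, ← Matrix.mulVec_mulVec, hW, hV]
  inv_mem' := fun {W} hW => by
    simp only [Set.mem_ofPred_eq] at hW
    have : ((W⁻¹ * W : Matrix.unitaryGroup (Fin D) ℂ) : Matrix (Fin D) (Fin D) ℂ) *ᵥ
        Pi.single i 1 = Pi.single i 1 := by
      rw [inv_mul_cancel]
      exact Matrix.one_mulVec _
    rwa [Submonoid.coe_mul, ← Matrix.mulVec_mulVec, hW] at this

theorem continuous_unitary_mulVec {D : ℕ} (x : Fin D → ℂ) :
    Continuous fun W : Matrix.unitaryGroup (Fin D) ℂ => (W : Matrix (Fin D) (Fin D) ℂ) *ᵥ x :=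
  continuous_subtype_val.matrix_mulVec continuous_const

instance compactSpace_basisStabilizer {D : ℕ} (i : Fin D) : CompactSpace (basisStabilizer i) := by
  have : IsClosed (basisStabilizer i : Set (Matrix.unitaryGroup (Fin D) ℂ)) :=
    isClosed_eq (continuous_unitary_mulVec _) continuous_const
  exact isCompact_iff_compactSpace.mp this.isCompact

theorem coordProj_erase {D : ℕ} (i : Fin D) (g : Fin D → ℂ) :
    coordProj (Finset.univ.erase i) g = g - g i • Pi.single i 1 := by
  ext j
  by_cases h : j = i
  · subst h
    simp [coordProj]
  · simp [coordProj, h]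

theorem mulVec_coordProj_erase {D : ℕ} {i : Fin D} {W : Matrix.unitaryGroup (Fin D) ℂ}
    (hW : W ∈ basisStabilizer i) (g : Fin D → ℂ) :
    (W : Matrix (Fin D) (Fin D) ℂ) *ᵥ coordProj (Finset.univ.erase i) g =
      coordProj (Finset.univ.erase i) ((W : Matrix (Fin D) (Fin D) ℂ) *ᵥ g) := by
  have hW1 : (W : Matrix (Fin D) (Fin D) ℂ) *ᵥ Pi.single i 1 = Pi.single i 1 := hW
  have hW2 : (star (W : Matrix (Fin D) (Fin D) ℂ)) *ᵥ Pi.single i 1 = Pi.single i 1 :=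
    (basisStabilizer i).inv_mem hW
  have h : ((W : Matrix (Fin D) (Fin D) ℂ) *ᵥ g) i = g i := by
    have e : ∀ y : Fin D → ℂ, y i = star (Pi.single i 1 : Fin D → ℂ) ⬝ᵥ y := by
      intro y
      rw [← Pi.single_star]
      simp
    rw [e (_ *ᵥ g), e g, Matrix.dotProduct_mulVec]
    conv_rhs => rw [← hW2]
    rw [Matrix.star_mulVec, Matrix.star_eq_conjTranspose, Matrix.conjTranspose_conjTranspose]
  rw [coordProj_erase, coordProj_erase, h, Matrix.mulVec_sub, Matrix.mulVec_smul, hW1]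

/-- Conditionally on a column of a Haar unitary `V`, a vector that depends equivariantly on `V` is
uniformly distributed in the complementary directions. -/
theorem haarUnitary_equivariant_le_complexGaussian {D : ℕ} (i : Fin D)
    {X : Matrix.unitaryGroup (Fin D) ℂ → Fin D → ℂ} (hX : Continuous X)
    (hXW : ∀ V, ∀ W ∈ basisStabilizer i, X (V * W⁻¹) = (W : Matrix (Fin D) (Fin D) ℂ) *ᵥ X V)
    {A : Set (Fin D → ℂ)}
    (hA : IsClosed A) (hA0 : 0 ∈ A) (hAs : ∀ c : ℝ, 0 < c → ∀ y ∈ A, (c : ℂ) • y ∈ A) :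
    haarUnitary D {V | coordProj (Finset.univ.erase i) (X V) ∈ A ∧
        coordProj (Finset.univ.erase i) (X V) ≠ 0} ≤
      complexGaussian D {g | coordProj (Finset.univ.erase i) g ∈ A} := by
  set S := Finset.univ.erase i with hS
  set B := {V | coordProj S (X V) ∈ A ∧ coordProj S (X V) ≠ 0} with hB
  -- Right invariance allows averaging over `V W⁻¹` with `W` distributed by `κ`. For fixed `V` this
  -- moves the projected vector along its orbit under the stabilizer, where the orbit comparison
  -- applies unless the vector is zero.
  let κ := Measure.haarMeasure (⊤ : TopologicalSpace.PositiveCompacts (basisStabilizer i))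
  have hproj : Continuous (coordProj S : (Fin D → ℂ) → _) := by
    refine continuous_pi fun j => ?_
    unfold coordProj
    split_ifs <;> fun_prop
  have hBm : MeasurableSet B :=
    (hA.preimage (hproj.comp hX)).measurableSet.inter
      (isOpen_compl_singleton.preimage (hproj.comp hX)).measurableSet
  have hcont : Continuous fun p : Matrix.unitaryGroup (Fin D) ℂ × basisStabilizer i =>
      p.1 * (p.2 : Matrix.unitaryGroup (Fin D) ℂ)⁻¹ := by fun_prop
  have hmeas := hcont.measurable hBm
  have hinv : ∀ W : basisStabilizer i,
      haarUnitary D {V | V * (W : Matrix.unitaryGroup (Fin D) ℂ)⁻¹ ∈ B} = haarUnitary D B := by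
    intro W
    conv_rhs => rw [haarUnitary,
      ← map_mul_right_haarMeasure_top (W : Matrix.unitaryGroup (Fin D) ℂ)⁻¹,
      Measure.map_apply (continuous_mul_const _).measurable hBm]
    rfl
  have hfib : ∀ V, κ {W | V * (W : Matrix.unitaryGroup (Fin D) ℂ)⁻¹ ∈ B} ≤
      complexGaussian D {g | coordProj S g ∈ A} := by
    intro V
    have e : {W : basisStabilizer i | V * (W : Matrix.unitaryGroup (Fin D) ℂ)⁻¹ ∈ B} ⊆
        {W | ((W : Matrix.unitaryGroup (Fin D) ℂ) : Matrix (Fin D) (Fin D) ℂ) *ᵥ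
          coordProj S (X V) ∈ A ∧ coordProj S (X V) ≠ 0} := by
      rintro W ⟨h1, h2⟩
      rw [hXW V W W.2, ← mulVec_coordProj_erase W.2] at h1 h2
      refine ⟨h1, fun h => h2 ?_⟩
      rw [h, Matrix.mulVec_zero]
    by_cases h0 : coordProj S (X V) = 0
    · refine (measure_mono e).trans ?_
      simp [h0]
    · refine (measure_mono (e.trans fun W hW => hW.1)).trans ?_
      refine haarMeasure_orbit_le_complexGaussian (basisStabilizer i).subtype
        continuous_subtype_val S (fun W g => mulVec_coordProj_erase W.2 g) ?_ hA hA0 hAs h0 ?_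
      · intro x y hx hy hxy
        obtain ⟨W, hW, hW'⟩ := exists_unitary_mulVec_eq (x := x) (y := y) (by
          rw [← sum_normSq_eq_star_dotProduct, hxy, sum_normSq_eq_star_dotProduct])
        have hz : ∀ z : Fin D → ℂ, coordProj S z = z → star z ⬝ᵥ Pi.single i 1 = 0 := by
          intro z hz
          have := congrFun hz i
          simp only [coordProj, hS, Finset.mem_erase, ne_eq, not_true, false_and, if_false] at this
          simp [← this]
        exact ⟨⟨W, hW' _ (hz x hx) (hz y hy)⟩, hW⟩
      · ext j
        simp only [coordProj]
        split_ifs <;> rfl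
  calc haarUnitary D B = ∫⁻ W, haarUnitary D
          {V | V * (W : Matrix.unitaryGroup (Fin D) ℂ)⁻¹ ∈ B} ∂κ := by
        simp [hinv, κ]
    _ = ((haarUnitary D).prod κ) ((fun p : Matrix.unitaryGroup (Fin D) ℂ × basisStabilizer i =>
          p.1 * (p.2 : Matrix.unitaryGroup (Fin D) ℂ)⁻¹) ⁻¹' B) := by
        rw [Measure.prod_apply_symm hmeas]
        rfl
    _ = ∫⁻ V, κ {W | V * (W : Matrix.unitaryGroup (Fin D) ℂ)⁻¹ ∈ B} ∂haarUnitary D := by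
        rw [Measure.prod_apply hmeas]
        rfl
    _ ≤ ∫⁻ _, complexGaussian D {g | coordProj S g ∈ A} ∂haarUnitary D := lintegral_mono hfib
    _ = complexGaussian D {g | coordProj S g ∈ A} := by simp

/-! ### Overlaps as block sums of squared matrix entries -/

/-- The matrix `V† diag(u) V`. -/
noncomputable def conjDiag {D : ℕ} (V : Matrix.unitaryGroup (Fin D) ℂ) (u : Fin D → ℂ) :
    Matrix (Fin D) (Fin D) ℂ :=
  (V : Matrix (Fin D) (Fin D) ℂ)ᴴ * Matrix.diagonal u * (V : Matrix (Fin D) (Fin D) ℂ)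

/-- The indices of the basis vectors of `ℂ^{dS * dE}` in the `k`-th subsystem state. -/
def block {dS dE : ℕ} (k : Fin dS) : Finset (Fin (dS * dE)) :=
  Finset.univ.filter fun m => (finProdFinEquiv.symm m).1 = k

theorem card_block {dS dE : ℕ} (k : Fin dS) : (block (dE := dE) k).card = dE := by
  have : block (dE := dE) k =
      (Finset.univ : Finset (Fin dE)).map
        ⟨fun e => finProdFinEquiv (k, e), fun a b h => by simpa using h⟩ := by
    ext m
    simp only [block, Finset.mem_filter, Finset.mem_univ, true_and, Finset.mem_map]
    constructor
    · intro h
      exact ⟨(finProdFinEquiv.symm m).2, by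
        rw [← h]
        exact finProdFinEquiv.apply_symm_apply m⟩
    · rintro ⟨e, rfl⟩
      exact congrArg Prod.fst (finProdFinEquiv.symm_apply_apply (k, e))
  rw [this, Finset.card_map, Finset.card_univ, Fintype.card_fin]

theorem subsystemProjector_eq {dS dE : ℕ} (V : Matrix.unitaryGroup (Fin (dS * dE)) ℂ)
    (k : Fin dS) :
    subsystemProjector V k = (V : Matrix (Fin (dS * dE)) (Fin (dS * dE)) ℂ) *
      Matrix.diagonal (fun m => if m ∈ block (dE := dE) k then (1 : ℂ) else 0) *
      (V : Matrix (Fin (dS * dE)) (Fin (dS * dE)) ℂ)ᴴ := by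
  unfold subsystemProjector
  congr 2
  ext m n
  obtain ⟨⟨k1, e1⟩, rfl⟩ := finProdFinEquiv.surjective m
  obtain ⟨⟨k2, e2⟩, rfl⟩ := finProdFinEquiv.surjective n
  simp only [Matrix.reindex_apply, Matrix.submatrix_apply, Equiv.symm_apply_apply,
    Matrix.kroneckerMap_apply, Matrix.diagonal_apply, Matrix.single_apply, Matrix.one_apply, block,
    Finset.mem_filter, Finset.mem_univ, true_and, EmbeddingLike.apply_eq_iff_eq, Prod.mk.injEq]
  by_cases h1 : k = k1 <;> by_cases h2 : k = k2 <;> by_cases h3 : e1 = e2 <;>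
    simp_all [eq_comm]

/-- The overlaps of the basis states of a subsystem under the evolution `diag(u)`. -/
noncomputable def blockOverlap {dS dE : ℕ} (V : Matrix.unitaryGroup (Fin (dS * dE)) ℂ)
    (u : Fin (dS * dE) → ℂ) (k l : Fin dS) : ℝ :=
  (dE : ℝ)⁻¹ * ∑ i ∈ block k, ∑ j ∈ block l, ‖conjDiag V u j i‖ ^ 2

/-- By cyclicity of the trace, both `V`s can be moved onto the evolution, leaving the squared
Hilbert–Schmidt norm of one block of `conjDiag V u`. -/
theorem subsystemOverlap_eq {dS dE : ℕ} {H : Matrix (Fin (dS * dE)) (Fin (dS * dE)) ℂ} {t : ℝ}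
    {u : Fin (dS * dE) → ℂ} (hu : evolution H t = Matrix.diagonal u)
    (V : Matrix.unitaryGroup (Fin (dS * dE)) ℂ) (k l : Fin dS) :
    subsystemOverlap H V t k l = (blockOverlap V u k l : ℂ) := by
  set p : Fin dS → Matrix (Fin (dS * dE)) (Fin (dS * dE)) ℂ := fun k =>
    Matrix.diagonal (fun m => if m ∈ block (dE := dE) k then (1 : ℂ) else 0) with hp
  have h : (evolution H t * subsystemProjector V k * (evolution H t)ᴴ *
      subsystemProjector V l).trace =
      (p l * conjDiag V u * (p k * (conjDiag V u)ᴴ)).trace := by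
    rw [subsystemProjector_eq, subsystemProjector_eq, hu, conjDiag]
    set W := (V : Matrix (Fin (dS * dE)) (Fin (dS * dE)) ℂ)
    set B := Matrix.diagonal u * W * p k * Wᴴ * (Matrix.diagonal u)ᴴ * W with hB
    trans (B * p l * Wᴴ).trace
    · simp only [hB, hp, Matrix.mul_assoc]
    · rw [Matrix.trace_mul_comm, ← Matrix.mul_assoc, Matrix.trace_mul_comm]
      simp only [hB, Matrix.conjTranspose_mul, Matrix.conjTranspose_conjTranspose,
        Matrix.mul_assoc]
  rw [subsystemOverlap, h, blockOverlap]
  push_cast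
  congr 1
  have e : ∀ j i, (p l * conjDiag V u) j i * (p k * (conjDiag V u)ᴴ) i j =
      if i ∈ block (dE := dE) k then
        if j ∈ block (dE := dE) l then (‖conjDiag V u j i‖ : ℂ) ^ 2 else 0 else 0 := by
    intro j i
    simp only [hp, Matrix.diagonal_mul, Matrix.conjTranspose_apply]
    split_ifs <;> simp [Complex.mul_conj, Complex.normSq_eq_norm_sq]
  rw [Matrix.trace]
  simp only [Matrix.diag_apply, Matrix.mul_apply (M := p l * conjDiag V u)]
  simp_rw [e]
  rw [Finset.sum_comm]
  simp only [Finset.sum_ite_irrel, Finset.sum_const_zero, Finset.sum_ite_mem, Finset.univ_inter]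

theorem conjDiag_mem_unitaryGroup {D : ℕ} (V : Matrix.unitaryGroup (Fin D) ℂ) {u : Fin D → ℂ}
    (hu : ∀ j, ‖u j‖ = 1) : conjDiag V u ∈ Matrix.unitaryGroup (Fin D) ℂ := by
  have h : Matrix.diagonal u ∈ Matrix.unitaryGroup (Fin D) ℂ := by
    rw [Matrix.mem_unitaryGroup_iff, Matrix.star_eq_conjTranspose, Matrix.diagonal_conjTranspose,
      Matrix.diagonal_mul_diagonal, ← Matrix.diagonal_one]
    congr 1
    ext j
    rw [Pi.star_apply, Complex.star_def, Complex.mul_conj, Complex.normSq_eq_norm_sq, hu]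
    simp
  exact mul_mem (mul_mem (Unitary.star_mem V.2) h) V.2

theorem sum_normSq_column {D : ℕ} {M : Matrix (Fin D) (Fin D) ℂ}
    (hM : M ∈ Matrix.unitaryGroup (Fin D) ℂ) (i : Fin D) : ∑ j, ‖M j i‖ ^ 2 = 1 := by
  have h := sum_normSq_mulVec_of_unitary ⟨M, hM⟩ (Pi.single i 1)
  simp only [Matrix.mulVec_single_one, Matrix.col_apply] at h
  rw [h, Finset.sum_eq_single i] <;> simp +contextual

theorem conjDiag_diag {D : ℕ} (V : Matrix.unitaryGroup (Fin D) ℂ) (u : Fin D → ℂ) (i : Fin D) :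
    conjDiag V u i i = ∑ m, u m * ((‖(V : Matrix (Fin D) (Fin D) ℂ) m i‖ ^ 2 : ℝ) : ℂ) := by
  rw [conjDiag, Matrix.mul_apply]
  refine Finset.sum_congr rfl fun m _ => ?_
  rw [Matrix.mul_diagonal, Matrix.conjTranspose_apply, ← Complex.normSq_eq_norm_sq,
    Complex.normSq_eq_conj_mul_self, Complex.star_def]
  ring

theorem norm_conjDiag_sub_le {D : ℕ} (V : Matrix.unitaryGroup (Fin D) ℂ) (u v : Fin D → ℂ)
    (i j : Fin D) : ‖conjDiag V u j i - conjDiag V v j i‖ ≤ ∑ m, ‖u m - v m‖ := by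
  simp only [conjDiag, Matrix.mul_apply (N := (V : Matrix (Fin D) (Fin D) ℂ)),
    Matrix.mul_diagonal, Matrix.conjTranspose_apply]
  rw [← Finset.sum_sub_distrib]
  refine norm_sum_le_of_le _ fun m _ => ?_
  rw [← sub_mul, ← mul_sub, norm_mul, norm_mul, norm_star]
  have h1 := entry_norm_bound_of_unitary V.2 m j
  have h2 := entry_norm_bound_of_unitary V.2 m i
  calc _ ≤ 1 * ‖u m - v m‖ * 1 := by gcongr
    _ = _ := by ring

/-- Crude continuity in the phases, used to pass from a time grid to all times. The loss is only
polynomial in the dimensions, so a fine grid compensates for it. -/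
theorem abs_blockOverlap_sub_le {dS dE : ℕ} (V : Matrix.unitaryGroup (Fin (dS * dE)) ℂ)
    {u v : Fin (dS * dE) → ℂ} (hu : ∀ j, ‖u j‖ = 1) (hv : ∀ j, ‖v j‖ = 1) (k l : Fin dS) :
    |blockOverlap V u k l - blockOverlap V v k l| ≤ 2 * dE * ∑ m, ‖u m - v m‖ := by
  set s := ∑ m, ‖u m - v m‖ with hs
  have h : ∀ i j, |‖conjDiag V u j i‖ ^ 2 - ‖conjDiag V v j i‖ ^ 2| ≤ 2 * s := by
    intro i j
    have h1 := entry_norm_bound_of_unitary (conjDiag_mem_unitaryGroup V hu) j i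
    have h2 := entry_norm_bound_of_unitary (conjDiag_mem_unitaryGroup V hv) j i
    have h3 := (abs_norm_sub_norm_le _ _).trans (norm_conjDiag_sub_le V u v i j)
    rw [sq_sub_sq, abs_mul, abs_of_nonneg (by positivity)]
    calc _ ≤ (1 + 1) * s := by gcongr
      _ = _ := by ring
  rw [blockOverlap, blockOverlap, ← mul_sub, ← Finset.sum_sub_distrib, abs_mul,
    abs_of_nonneg (by positivity)]
  have h4 : |∑ i ∈ block k, (∑ j ∈ block l, ‖conjDiag V u j i‖ ^ 2 -
      ∑ j ∈ block l, ‖conjDiag V v j i‖ ^ 2)| ≤ dE * (dE * (2 * s)) := by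
    calc _ ≤ ∑ i ∈ block (dE := dE) k, ∑ j ∈ block (dE := dE) l, 2 * s := by
          refine (Finset.abs_sum_le_sum_abs _ _).trans (Finset.sum_le_sum fun i _ => ?_)
          rw [← Finset.sum_sub_distrib]
          exact (Finset.abs_sum_le_sum_abs _ _).trans (Finset.sum_le_sum fun j _ => h i j)
      _ = _ := by simp [card_block]
  rcases Nat.eq_zero_or_pos dE with h0 | h0
  · subst h0
    simp
  · have : (0 : ℝ) < dE := by exact_mod_cast h0
    calc _ ≤ (dE : ℝ)⁻¹ * (dE * (dE * (2 * s))) := by gcongr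
      _ = _ := by field_simp

/-- Each column has norm one, and the overlap averages the block shares of `dE` columns. For a
column, the diagonal entry may be added to the block and is missing from the off-diagonal total, at
a relative cost of `36 η` each; the uneven distribution of the rest costs `8 η`, whence `80 η`. -/
theorem abs_blockOverlap_sub_inv_le {dS dE : ℕ} (hdE : 0 < dE) {η : ℝ} (hη : 0 ≤ η)
    (V : Matrix.unitaryGroup (Fin (dS * dE)) ℂ) {u : Fin (dS * dE) → ℂ} (hu : ∀ j, ‖u j‖ = 1)
    (h1 : ∀ i, ‖conjDiag V u i i‖ ^ 2 ≤ 36 * (η / dS))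
    (h2 : ∀ i (l : Fin dS), |dS * ∑ j ∈ (block (dE := dE) l).erase i, ‖conjDiag V u j i‖ ^ 2 -
      ∑ j ∈ Finset.univ.erase i, ‖conjDiag V u j i‖ ^ 2| ≤
        8 * η * ∑ j ∈ Finset.univ.erase i, ‖conjDiag V u j i‖ ^ 2) (k l : Fin dS) :
    |blockOverlap V u k l - (dS : ℝ)⁻¹| ≤ 80 * η / dS := by
  have hdS : (1 : ℝ) ≤ dS := by exact_mod_cast Fin.pos k
  have hdE' : (0 : ℝ) < dE := by exact_mod_cast hdE
  have hcol : ∀ i, |∑ j ∈ block (dE := dE) l, ‖conjDiag V u j i‖ ^ 2 - (dS : ℝ)⁻¹| ≤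
      80 * η / dS := by
    intro i
    have hs := sum_normSq_column (conjDiag_mem_unitaryGroup V hu) i
    rw [← Finset.add_sum_erase _ _ (Finset.mem_univ i)] at hs
    have hb : ∃ c : ℝ, 0 ≤ c ∧ c ≤ ‖conjDiag V u i i‖ ^ 2 ∧
        ∑ j ∈ block (dE := dE) l, ‖conjDiag V u j i‖ ^ 2 =
          c + ∑ j ∈ (block (dE := dE) l).erase i, ‖conjDiag V u j i‖ ^ 2 := by
      by_cases hi : i ∈ block (dE := dE) l
      · exact ⟨_, by positivity, le_rfl, (Finset.add_sum_erase _ _ hi).symm⟩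
      · exact ⟨0, le_rfl, by positivity, by rw [Finset.erase_eq_of_notMem hi, zero_add]⟩
    obtain ⟨c, hc0, hc1, hc2⟩ := hb
    rw [hc2]
    have h3 := h2 i l
    have h4 := h1 i
    set s := ∑ j ∈ (block (dE := dE) l).erase i, ‖conjDiag V u j i‖ ^ 2
    set r := ∑ j ∈ Finset.univ.erase i, ‖conjDiag V u j i‖ ^ 2
    set q := ‖conjDiag V u i i‖ ^ 2
    have hq : 0 ≤ q := by positivity
    have h5 : dS * q ≤ 36 * η := by
      calc dS * q ≤ dS * (36 * (η / dS)) := by gcongr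
        _ = 36 * η := by field_simp
    have h6 : dS * c ≤ dS * q := by gcongr
    have h7 : 0 ≤ dS * c := by positivity
    have h8 : q ≤ dS * q := le_mul_of_one_le_left hq hdS
    have h9 : 8 * η * r ≤ 8 * η := mul_le_of_le_one_right (by positivity) (by linarith)
    rw [abs_le] at h3
    have h10 : |dS * (c + s) - 1| ≤ 80 * η := by
      rw [abs_le]
      constructor <;> linarith [h3.1, h3.2]
    have h11 : c + s - (dS : ℝ)⁻¹ = (dS * (c + s) - 1) / dS := by field_simp
    rw [h11, abs_div, abs_of_pos (show (0 : ℝ) < dS by linarith)]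
    gcongr
  have e : blockOverlap V u k l - (dS : ℝ)⁻¹ =
      (dE : ℝ)⁻¹ * ∑ i ∈ block (dE := dE) k,
        (∑ j ∈ block (dE := dE) l, ‖conjDiag V u j i‖ ^ 2 - (dS : ℝ)⁻¹) := by
    rw [Finset.sum_sub_distrib, mul_sub, blockOverlap]
    congr 1
    rw [Finset.sum_const, card_block, nsmul_eq_mul]
    field_simp
  rw [e, abs_mul, abs_of_nonneg (by positivity)]
  calc _ ≤ (dE : ℝ)⁻¹ * ∑ i ∈ block (dE := dE) k, 80 * η / dS := by
        gcongr
        exact (Finset.abs_sum_le_sum_abs _ _).trans (Finset.sum_le_sum fun i _ => hcol i)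
    _ = _ := by
        rw [Finset.sum_const, card_block, nsmul_eq_mul]
        field_simp

/-! ### Concentration at a fixed time -/

theorem exp_neg_le_of_le {x y : ℝ} (h : y ≤ x) :
    ENNReal.ofReal (Real.exp (-x)) ≤ ENNReal.ofReal (Real.exp (-y)) :=
  ENNReal.ofReal_le_ofReal (Real.exp_le_exp.2 (neg_le_neg h))

/-- The diagonal entries of a diagonal unitary of small trace, in a Haar random basis. -/
theorem haarUnitary_diag_le {D : ℕ} {u : Fin D → ℂ} (hu : ∀ j, ‖u j‖ = 1) {ε : ℝ} (hε : 0 ≤ ε)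
    (hε1 : ε ≤ 1 / 2) (htr : ‖∑ j, u j‖ ≤ ε * D) (i : Fin D) :
    haarUnitary D {V | 6 * ε < ‖conjDiag V u i i‖} ≤
      6 * ENNReal.ofReal (Real.exp (-(ε ^ 2 * D / 8))) := by
  have hD : (0 : ℝ) < D := by exact_mod_cast i.pos
  -- The condition on a unit column is made homogeneous by the factor `∑ ‖y j‖²`. For a typical
  -- Gaussian vector this factor exceeds `D`, while the right side is below `2 (ε D + ε D + ε D)`:
  -- real fluctuation, imaginary fluctuation and trace. This explains the `6`.
  set A : Set (Fin D → ℂ) := {y | 6 * ε * ∑ j, ‖y j‖ ^ 2 ≤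
    ‖∑ j, u j * ((‖y j‖ ^ 2 : ℝ) : ℂ)‖} with hA
  have hAc : IsClosed A := isClosed_le (by fun_prop) (by fun_prop)
  have hA0 : (0 : Fin D → ℂ) ∈ A := by simp [hA]
  have hAs : ∀ c : ℝ, 0 < c → ∀ y ∈ A, (c : ℂ) • y ∈ A := by
    intro c hc y hy
    have e1 : ∑ j, ‖((c : ℂ) • y) j‖ ^ 2 = c ^ 2 * ∑ j, ‖y j‖ ^ 2 := by
      rw [Finset.mul_sum]
      exact Finset.sum_congr rfl fun j _ => by simp [mul_pow]
    have e2 : ∑ j, u j * ((‖((c : ℂ) • y) j‖ ^ 2 : ℝ) : ℂ) =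
        ((c ^ 2 : ℝ) : ℂ) * ∑ j, u j * ((‖y j‖ ^ 2 : ℝ) : ℂ) := by
      rw [Finset.mul_sum]
      refine Finset.sum_congr rfl fun j _ => ?_
      have : ‖((c : ℂ) • y) j‖ ^ 2 = c ^ 2 * ‖y j‖ ^ 2 := by simp [mul_pow]
      rw [this]
      push_cast
      ring
    have hy' : 6 * ε * ∑ j, ‖y j‖ ^ 2 ≤ ‖∑ j, u j * ((‖y j‖ ^ 2 : ℝ) : ℂ)‖ := hy
    show 6 * ε * ∑ j, ‖((c : ℂ) • y) j‖ ^ 2 ≤ ‖∑ j, u j * ((‖((c : ℂ) • y) j‖ ^ 2 : ℝ) : ℂ)‖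
    rw [e1, e2, norm_mul, Complex.norm_real, Real.norm_of_nonneg (by positivity)]
    calc _ = c ^ 2 * (6 * ε * ∑ j, ‖y j‖ ^ 2) := by ring
      _ ≤ _ := by gcongr
  have h1 : haarUnitary D {V | 6 * ε < ‖conjDiag V u i i‖} ≤ complexGaussian D A := by
    refine le_trans (measure_mono fun V hV => ?_)
      (haarUnitary_column_le_complexGaussian i hAc hA0 hAs)
    have h := sum_normSq_column V.2 i
    have hV' : 6 * ε < ‖conjDiag V u i i‖ := hV
    rw [conjDiag_diag] at hV'
    simp only [Set.mem_ofPred_eq, hA, Matrix.mulVec_single_one, Matrix.col_apply]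
    rw [h, mul_one]
    exact hV'.le
  have hone : ∀ {a : Fin D → ℝ}, (∀ j, |a j| ≤ 1) → ∑ j, a j ^ 2 ≤ (D : ℝ) := by
    intro a ha
    calc ∑ j, a j ^ 2 ≤ ∑ _j : Fin D, (1 : ℝ) :=
          Finset.sum_le_sum fun j _ => (sq_le_one_iff_abs_le_one _).2 (ha j)
      _ = D := by simp
  have hre : ∀ j, |(u j).re| ≤ 1 := fun j => (Complex.abs_re_le_norm _).trans (hu j).le
  have him : ∀ j, |(u j).im| ≤ 1 := fun j => (Complex.abs_im_le_norm _).trans (hu j).le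
  have g1 := complexGaussian_le_of_abs_sum_le hre (hone hre) hε (by linarith)
  have g2 := complexGaussian_le_of_abs_sum_le him (hone him) hε (by linarith)
  have h11 : ∀ j : Fin D, |(fun _ => (1 : ℝ)) j| ≤ 1 := by simp
  have g3 := complexGaussian_le_of_abs_sum_le h11 (hone h11) (ε := 1 / 2) (by norm_num)
    (by norm_num)
  have g3' : ENNReal.ofReal (Real.exp (-((1 / 2) ^ 2 * D / 8))) ≤
      ENNReal.ofReal (Real.exp (-(ε ^ 2 * D / 8))) := by
    apply exp_neg_le_of_le
    gcongr
  refine h1.trans ?_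
  calc complexGaussian D A ≤ complexGaussian D
        (({g | ε * D ≤ |∑ j, (u j).re * (‖g j‖ ^ 2 / 2 - 1)|} ∪
          {g | ε * D ≤ |∑ j, (u j).im * (‖g j‖ ^ 2 / 2 - 1)|}) ∪
          {g | (1 / 2 : ℝ) * D ≤ |∑ j, (1 : ℝ) * (‖g j‖ ^ 2 / 2 - 1)|}) := by
        refine measure_mono fun g hg => ?_
        by_contra hn
        simp only [Set.mem_union, Set.mem_ofPred_eq, not_or, not_le] at hn
        obtain ⟨⟨n1, n2⟩, n3⟩ := hn
        have hg' : 6 * ε * ∑ j, ‖g j‖ ^ 2 ≤ ‖∑ j, u j * ((‖g j‖ ^ 2 : ℝ) : ℂ)‖ := hg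
        have n4 : ∑ j, (1 : ℝ) * (‖g j‖ ^ 2 / 2 - 1) = (∑ j, ‖g j‖ ^ 2) / 2 - D := by
          simp [Finset.sum_sub_distrib, Finset.sum_div]
        have n5 : (D : ℝ) < ∑ j, ‖g j‖ ^ 2 := by
          rw [n4] at n3
          linarith [(abs_lt.1 n3).1]
        set z := ∑ j, u j * ((‖g j‖ ^ 2 / 2 - 1 : ℝ) : ℂ) with hz
        have zre : z.re = ∑ j, (u j).re * (‖g j‖ ^ 2 / 2 - 1) := by
          rw [hz, Complex.re_sum]
          exact Finset.sum_congr rfl fun j _ => Complex.re_mul_ofReal _ _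
        have zim : z.im = ∑ j, (u j).im * (‖g j‖ ^ 2 / 2 - 1) := by
          rw [hz, Complex.im_sum]
          exact Finset.sum_congr rfl fun j _ => Complex.im_mul_ofReal _ _
        have n6 := Complex.norm_le_abs_re_add_abs_im z
        rw [zre, zim] at n6
        have n7 : ∑ j, u j * ((‖g j‖ ^ 2 : ℝ) : ℂ) = 2 * (z + ∑ j, u j) := by
          rw [hz, ← Finset.sum_add_distrib, Finset.mul_sum]
          refine Finset.sum_congr rfl fun j _ => ?_
          push_cast
          ring
        rw [n7, norm_mul, Complex.norm_two] at hg'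
        have n8 := norm_add_le z (∑ j, u j)
        have n9 : 6 * ε * D ≤ 6 * ε * ∑ j, ‖g j‖ ^ 2 := by gcongr
        linarith
    _ ≤ 2 * ENNReal.ofReal (Real.exp (-(ε ^ 2 * D / 8))) +
          2 * ENNReal.ofReal (Real.exp (-(ε ^ 2 * D / 8))) +
          2 * ENNReal.ofReal (Real.exp (-(ε ^ 2 * D / 8))) := by
        refine (measure_union_le _ _).trans (add_le_add
          ((measure_union_le _ _).trans (add_le_add g1 g2)) (g3.trans ?_))
        gcongr
    _ = _ := by ring

/-- The part of a column of `V† diag(u) V` in a block is close to its share of the column. -/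
theorem haarUnitary_block_le {D dS dE : ℕ} (hdS : 1 ≤ dS) (hD : D = dS * dE) {η : ℝ} (hη : 0 < η)
    (hη1 : η ≤ 1 / 4) (hdE : 1 ≤ η * dE) (u : Fin D → ℂ) (i : Fin D) {F : Finset (Fin D)}
    (hF : F.card = dE) :
    haarUnitary D {V | 8 * η * ∑ j ∈ Finset.univ.erase i, ‖conjDiag V u j i‖ ^ 2 <
        |dS * ∑ j ∈ F.erase i, ‖conjDiag V u j i‖ ^ 2 -
          ∑ j ∈ Finset.univ.erase i, ‖conjDiag V u j i‖ ^ 2|} ≤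
      4 * ENNReal.ofReal (Real.exp (-(η ^ 2 * dE / 8))) := by
  have hdS1 : (1 : ℝ) ≤ dS := by exact_mod_cast hdS
  have hDr : (D : ℝ) = dS * dE := by rw [hD]; push_cast; rfl
  have hdE0 : (0 : ℝ) ≤ dE := by positivity
  have hDdE : (dE : ℝ) ≤ D := by
    rw [hDr]
    exact le_mul_of_one_le_left hdE0 hdS1
  set S := (Finset.univ : Finset (Fin D)).erase i with hS
  set L := F.erase i with hL
  set A : Set (Fin D → ℂ) := {y | 8 * η * ∑ j ∈ S, ‖y j‖ ^ 2 ≤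
    |dS * ∑ j ∈ L, ‖y j‖ ^ 2 - ∑ j ∈ S, ‖y j‖ ^ 2|} with hA
  have hAc : IsClosed A := isClosed_le (by fun_prop) (by fun_prop)
  have hA0 : (0 : Fin D → ℂ) ∈ A := by simp [hA]
  have hAs : ∀ c : ℝ, 0 < c → ∀ y ∈ A, (c : ℂ) • y ∈ A := by
    intro c hc y hy
    have e1 : ∀ F : Finset (Fin D), ∑ j ∈ F, ‖((c : ℂ) • y) j‖ ^ 2 = c ^ 2 * ∑ j ∈ F, ‖y j‖ ^ 2 := by
      intro F
      rw [Finset.mul_sum]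
      exact Finset.sum_congr rfl fun j _ => by simp [mul_pow]
    have hy' : 8 * η * ∑ j ∈ S, ‖y j‖ ^ 2 ≤ |dS * ∑ j ∈ L, ‖y j‖ ^ 2 - ∑ j ∈ S, ‖y j‖ ^ 2| := hy
    show 8 * η * ∑ j ∈ S, ‖((c : ℂ) • y) j‖ ^ 2 ≤
      |dS * ∑ j ∈ L, ‖((c : ℂ) • y) j‖ ^ 2 - ∑ j ∈ S, ‖((c : ℂ) • y) j‖ ^ 2|
    rw [e1, e1]
    rw [show dS * (c ^ 2 * ∑ j ∈ L, ‖y j‖ ^ 2) - c ^ 2 * ∑ j ∈ S, ‖y j‖ ^ 2 =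
      c ^ 2 * (dS * ∑ j ∈ L, ‖y j‖ ^ 2 - ∑ j ∈ S, ‖y j‖ ^ 2) by ring, abs_mul,
      abs_of_nonneg (show 0 ≤ c ^ 2 by positivity)]
    calc _ = c ^ 2 * (8 * η * ∑ j ∈ S, ‖y j‖ ^ 2) := by ring
      _ ≤ _ := by gcongr
  have hLS : L ⊆ S := Finset.erase_subset_erase _ (Finset.subset_univ _)
  have hprojA : ∀ g : Fin D → ℂ, coordProj S g ∈ A ↔ g ∈ A := by
    intro g
    have e : ∀ F ⊆ S, ∑ j ∈ F, ‖coordProj S g j‖ ^ 2 = ∑ j ∈ F, ‖g j‖ ^ 2 := by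
      intro F hF
      refine Finset.sum_congr rfl fun j hj => ?_
      rw [coordProj, if_pos (hF hj)]
    simp only [hA, Set.mem_ofPred_eq, e _ hLS, e _ subset_rfl]
  let X : Matrix.unitaryGroup (Fin D) ℂ → Fin D → ℂ := fun V => conjDiag V u *ᵥ Pi.single i 1
  have hXi : ∀ V j, X V j = conjDiag V u j i := by
    intro V j
    simp [X]
  have hX : Continuous X := by
    have : Continuous fun V : Matrix.unitaryGroup (Fin D) ℂ => conjDiag V u := by
      unfold conjDiag
      exact (continuous_subtype_val.matrix_conjTranspose.matrix_mul continuous_const).matrix_mul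
        continuous_subtype_val
    exact this.matrix_mulVec continuous_const
  -- `(V W⁻¹)† diag(u) V W⁻¹ eᵢ = W V† diag(u) V eᵢ`, because `W⁻¹` fixes `eᵢ`.
  have hXW : ∀ V, ∀ W ∈ basisStabilizer i,
      X (V * W⁻¹) = (W : Matrix (Fin D) (Fin D) ℂ) *ᵥ X V := by
    intro V W hW
    have hW' : ((W⁻¹ : Matrix.unitaryGroup (Fin D) ℂ) : Matrix (Fin D) (Fin D) ℂ) *ᵥ
        Pi.single i 1 = Pi.single i 1 := (basisStabilizer i).inv_mem hW
    have hW2 : ((W⁻¹ : Matrix.unitaryGroup (Fin D) ℂ) : Matrix (Fin D) (Fin D) ℂ)ᴴ = W := by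
      show (star (W : Matrix (Fin D) (Fin D) ℂ))ᴴ = W
      rw [Matrix.star_eq_conjTranspose, Matrix.conjTranspose_conjTranspose]
    simp only [X, conjDiag, Submonoid.coe_mul, Matrix.conjTranspose_mul, hW2,
      ← Matrix.mulVec_mulVec, hW']
  have h1 := haarUnitary_equivariant_le_complexGaussian i hX hXW hAc hA0 hAs
  simp only [← hS, hprojA] at h1
  refine le_trans (measure_mono fun V hV => ?_) (h1.trans ?_)
  · have hV' : 8 * η * ∑ j ∈ S, ‖conjDiag V u j i‖ ^ 2 <
        |dS * ∑ j ∈ L, ‖conjDiag V u j i‖ ^ 2 - ∑ j ∈ S, ‖conjDiag V u j i‖ ^ 2| := hV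
    refine ⟨?_, fun h0 => ?_⟩
    · show 8 * η * ∑ j ∈ S, ‖X V j‖ ^ 2 ≤ |dS * ∑ j ∈ L, ‖X V j‖ ^ 2 - ∑ j ∈ S, ‖X V j‖ ^ 2|
      simp only [hXi]
      exact hV'.le
    -- A vanishing off-diagonal part would turn the strict inequality into `0 < 0`.
    · have h0' : ∀ j ∈ S, conjDiag V u j i = 0 := by
        intro j hj
        have := congrFun h0 j
        rwa [coordProj, if_pos hj, hXi] at this
      rw [Finset.sum_eq_zero (s := S) fun j hj => by simp [h0' j hj],
        Finset.sum_eq_zero (s := L) fun j hj => by simp [h0' j (hLS hj)]] at hV'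
      simp at hV'
  have hind : ∀ F : Finset (Fin D), ∀ j, |(fun j => if j ∈ F then (1 : ℝ) else 0) j| ≤ 1 := by
    intro F j
    simp only
    split_ifs <;> simp
  have hcard : ∀ F : Finset (Fin D), ∑ j, (fun j => if j ∈ F then (1 : ℝ) else 0) j ^ 2 =
      F.card := by
    intro F
    simp
  have hsum : ∀ (F : Finset (Fin D)) (g : Fin D → ℂ),
      ∑ j, (fun j => if j ∈ F then (1 : ℝ) else 0) j * (‖g j‖ ^ 2 / 2 - 1) =
        (∑ j ∈ F, ‖g j‖ ^ 2) / 2 - F.card := by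
    intro F g
    simp [Finset.sum_sub_distrib, Finset.sum_div]
  have hSc : (S.card : ℝ) = D - 1 := by
    rw [hS, Finset.card_erase_of_mem (Finset.mem_univ _), Finset.card_univ, Fintype.card_fin,
      Nat.cast_sub i.pos]
    simp
  have hLc : (L.card : ℝ) ≤ dE ∧ (dE : ℝ) - 1 ≤ L.card := by
    have c1 := Finset.card_erase_le (s := F) (a := i)
    have c2 := Finset.pred_card_le_card_erase (s := F) (a := i)
    rw [hF] at c1 c2
    refine ⟨by exact_mod_cast c1, ?_⟩
    have : dE ≤ L.card + 1 := by
      rw [hL]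
      omega
    have : (dE : ℝ) ≤ L.card + 1 := by exact_mod_cast this
    linarith
  have g1 := complexGaussian_le_of_abs_sum_le (hind L) ((hcard L).trans_le hLc.1) hη.le
    (by linarith)
  have g2 := complexGaussian_le_of_abs_sum_le (hind S) (M := D) (by rw [hcard, hSc]; linarith)
    hη.le (by linarith)
  have g2' : ENNReal.ofReal (Real.exp (-(η ^ 2 * D / 8))) ≤
      ENNReal.ofReal (Real.exp (-(η ^ 2 * dE / 8))) := by
    apply exp_neg_le_of_le
    gcongr
  simp only [hsum] at g1 g2
  calc complexGaussian D {g | g ∈ A} ≤ complexGaussian D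
        ({g | η * dE ≤ |(∑ j ∈ L, ‖g j‖ ^ 2) / 2 - L.card|} ∪
          {g | η * D ≤ |(∑ j ∈ S, ‖g j‖ ^ 2) / 2 - S.card|}) := by
        refine measure_mono fun g hg => ?_
        by_contra hn
        simp only [Set.mem_union, Set.mem_ofPred_eq, not_or, not_le] at hn
        obtain ⟨n1, n2⟩ := hn
        have hg' : 8 * η * ∑ j ∈ S, ‖g j‖ ^ 2 ≤
          |dS * ∑ j ∈ L, ‖g j‖ ^ 2 - ∑ j ∈ S, ‖g j‖ ^ 2| := hg
        set s := ∑ j ∈ L, ‖g j‖ ^ 2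
        set r := ∑ j ∈ S, ‖g j‖ ^ 2
        rw [abs_lt] at n1 n2
        rw [hSc] at n2
        have hηD : η * dE ≤ η * D := by gcongr
        -- Erasing `i` changes the cardinality by at most `1 ≤ η dE`, so the deviation doubles to `2
        -- η dE`. After scaling, `dS * s / 2` and `r / 2` both lie within `2 η D` of `D`; they
        -- differ by less than `4 η D`, and `D < r`.
        have s1 : s / 2 < dE + 2 * (η * dE) := by linarith [n1.2, hLc.1]
        have s2 : dE - 2 * (η * dE) < s / 2 := by linarith [n1.1, hLc.2]
        have s1' : dS * (s / 2) ≤ dS * (dE + 2 * (η * dE)) := by gcongr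
        have s2' : dS * (dE - 2 * (η * dE)) ≤ dS * (s / 2) := by gcongr
        have e1 : dS * (dE + 2 * (η * dE)) = D + 2 * (η * D) := by rw [hDr]; ring
        have e2 : dS * (dE - 2 * (η * dE)) = D - 2 * (η * D) := by rw [hDr]; ring
        have r1 : r / 2 < D + 2 * (η * D) := by linarith [n2.2]
        have r2 : D - 2 * (η * D) < r / 2 := by linarith [n2.1]
        have r3 : η * D ≤ 1 / 4 * D := by gcongr
        have r4 : η * D < η * r := by
          apply mul_lt_mul_of_pos_left _ hη
          linarith
        have : |dS * s - r| < 8 * η * r := by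
          rw [abs_lt]
          constructor <;> nlinarith
        linarith
    _ ≤ 2 * ENNReal.ofReal (Real.exp (-(η ^ 2 * dE / 8))) +
          2 * ENNReal.ofReal (Real.exp (-(η ^ 2 * dE / 8))) := by
        refine (measure_union_le _ _).trans (add_le_add g1 (g2.trans ?_))
        gcongr
    _ = _ := by ring

theorem haarUnitary_atypical_le {D dS dE : ℕ} (hdS : 1 ≤ dS) (hD : D = dS * dE) {η : ℝ}
    (hη : 0 < η) (hη1 : η ≤ 1 / 4) (hdE : 1 ≤ η * dE) {u : Fin D → ℂ} (hu : ∀ j, ‖u j‖ = 1)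
    (htr : ‖∑ j, u j‖ ^ 2 * dS ≤ η * (D : ℝ) ^ 2) {F : Fin dS → Finset (Fin D)}
    (hF : ∀ l, (F l).card = dE) :
    haarUnitary D ((⋃ i, {V | 6 * √(η / dS) < ‖conjDiag V u i i‖}) ∪
      ⋃ i, ⋃ l, {V | 8 * η * ∑ j ∈ Finset.univ.erase i, ‖conjDiag V u j i‖ ^ 2 <
        |dS * ∑ j ∈ (F l).erase i, ‖conjDiag V u j i‖ ^ 2 -
          ∑ j ∈ Finset.univ.erase i, ‖conjDiag V u j i‖ ^ 2|}) ≤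
      10 * (D : ℝ≥0∞) ^ 2 * ENNReal.ofReal (Real.exp (-(η ^ 2 * dE / 8))) := by
  have hdS' : (0 : ℝ) < dS := by exact_mod_cast hdS
  have hdE' : (0 : ℝ) < dE := by
    by_contra h
    nlinarith
  have hDr : (D : ℝ) = dS * dE := by rw [hD]; push_cast; rfl
  set q := ENNReal.ofReal (Real.exp (-(η ^ 2 * dE / 8))) with hq
  -- At this scale a diagonal entry has weight at most `36 η / dS`, comparable to the allowed error,
  -- while the exponent `ε² D = η dE` still dominates `η² dE`.
  set ε := √(η / dS) with hε
  have hε2 : ε ^ 2 = η / dS := Real.sq_sqrt (by positivity)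
  have hdS1 : (1 : ℝ) ≤ dS := by exact_mod_cast hdS
  have hε1 : ε ≤ 1 / 2 := by
    rw [hε, Real.sqrt_le_left (by norm_num)]
    calc η / dS ≤ η / 1 := by gcongr
      _ ≤ _ := by linarith
  have htr' : ‖∑ j, u j‖ ≤ ε * D := by
    refine le_of_sq_le_sq ?_ (by positivity)
    rw [mul_pow, hε2, div_mul_eq_mul_div, le_div_iff₀ hdS']
    exact htr
  have h1 : ∀ i, haarUnitary D {V | 6 * ε < ‖conjDiag V u i i‖} ≤ 6 * q := by
    intro i
    refine (haarUnitary_diag_le hu (Real.sqrt_nonneg _) hε1 htr' i).trans ?_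
    gcongr
    apply exp_neg_le_of_le
    rw [hε2, hDr, show η / dS * (dS * dE) = η * dE by field_simp]
    gcongr
    nlinarith
  calc _ ≤ ∑ _i : Fin D, 6 * q + ∑ _i : Fin D, ∑ _l : Fin dS, 4 * q := by
        refine (measure_union_le _ _).trans (add_le_add ?_ ?_)
        · exact (measure_iUnion_fintype_le _ _).trans (Finset.sum_le_sum fun i _ => h1 i)
        · refine (measure_iUnion_fintype_le _ _).trans (Finset.sum_le_sum fun i _ => ?_)
          exact (measure_iUnion_fintype_le _ _).trans (Finset.sum_le_sum fun l _ =>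
            haarUnitary_block_le hdS hD hη hη1 hdE u i (hF l))
    _ = (6 * D + 4 * (D * dS : ℕ) : ℕ) * q := by
        simp only [Finset.sum_const, Finset.card_univ, Fintype.card_fin, nsmul_eq_mul]
        push_cast
        ring
    _ ≤ (10 * D ^ 2 : ℕ) * q := by
        gcongr
        have hdE1 : 1 ≤ dE := by exact_mod_cast hdE'
        have h3 : dS ≤ D := hD ▸ Nat.le_mul_of_pos_right _ hdE1
        have h4 : 1 ≤ D := hdS.trans h3
        nlinarith
    _ = _ := by push_cast; rfl

/-- At a fixed time, scrambling fails with a probability that is exponentially small in `dE`. -/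
theorem haarUnitary_blockOverlap_le {dS dE : ℕ} {η : ℝ} (hη : 0 < η) (hη1 : η ≤ 1 / 4)
    (hdE : 1 ≤ η * dE) {u : Fin (dS * dE) → ℂ} (hu : ∀ j, ‖u j‖ = 1)
    (htr : ‖∑ j, u j‖ ^ 2 * dS ≤ η * ((dS * dE : ℕ) : ℝ) ^ 2) :
    haarUnitary (dS * dE) {V | ∃ k l, 80 * η / dS < |blockOverlap V u k l - (dS : ℝ)⁻¹|} ≤
      10 * ((dS * dE : ℕ) : ℝ≥0∞) ^ 2 * ENNReal.ofReal (Real.exp (-(η ^ 2 * dE / 8))) := by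
  rcases Nat.eq_zero_or_pos dS with h0 | hdS
  · subst h0
    simp
  refine le_trans (measure_mono fun V hV => ?_)
    (haarUnitary_atypical_le hdS rfl hη hη1 hdE hu htr card_block)
  by_contra hn
  simp only [Set.mem_union, Set.mem_iUnion, not_or, not_exists, Set.mem_ofPred_eq, not_lt] at hn
  obtain ⟨k, l, hkl⟩ := hV
  have hdE' : 0 < dE := by
    by_contra h
    obtain rfl : dE = 0 := by omega
    norm_num at hdE
  refine absurd (abs_blockOverlap_sub_inv_le hdE' hη.le V hu (fun i => ?_) hn.2 k l)
    (not_le.2 hkl)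
  calc ‖conjDiag V u i i‖ ^ 2 ≤ (6 * √(η / dS)) ^ 2 := by
        gcongr
        exact hn.1 i
    _ = 36 * (η / dS) := by
        rw [mul_pow, Real.sq_sqrt (by positivity)]
        norm_num

/-! ### Random energy levels -/

/-- Hoeffding's inequality for the empirical mean of a bounded function. -/
theorem pi_hoeffding {ν : Measure ℝ} [IsProbabilityMeasure ν] {f : ℝ → ℝ} (hf : Measurable f)
    (hf1 : ∀ x, |f x| ≤ 1) {D : ℕ} (hD : 0 < D) {s : ℝ} (hs : 0 ≤ s) :
    Measure.pi (fun _ : Fin D => ν) {E | D * s ≤ |∑ j, (f (E j) - ∫ x, f x ∂ν)|} ≤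
      ENNReal.ofReal (2 * Real.exp (-(D * s ^ 2 / 2))) := by
  have hD' : (0 : ℝ) < D := by exact_mod_cast hD
  have key : ∀ g : ℝ → ℝ, Measurable g → (∀ x, |g x| ≤ 1) →
      Measure.pi (fun _ : Fin D => ν) {E | D * s ≤ ∑ j, (g (E j) - ∫ x, g x ∂ν)} ≤
        ENNReal.ofReal (Real.exp (-(D * s ^ 2 / 2))) := by
    intro g hg hg1
    have hsub := ProbabilityTheory.hasSubgaussianMGF_of_mem_Icc (μ := ν) (X := g) (a := -1) (b := 1)
      hg.aemeasurable (ae_of_all _ fun x => abs_le.1 (hg1 x))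
    have hc : ((‖(1 : ℝ) - -1‖₊ / 2) ^ 2 : NNReal) = 1 := by
      rw [← NNReal.coe_inj]
      norm_num
    rw [hc] at hsub
    have hsub' : ∀ j : Fin D, ProbabilityTheory.HasSubgaussianMGF
        (fun E : Fin D → ℝ => g (E j) - ∫ x, g x ∂ν) 1 (Measure.pi fun _ : Fin D => ν) := by
      intro j
      refine ProbabilityTheory.HasSubgaussianMGF.of_map (Y := fun E : Fin D → ℝ => E j)
        (X := fun x => g x - ∫ x, g x ∂ν) (measurable_pi_apply j).aemeasurable ?_
      rwa [(measurePreserving_eval (fun _ : Fin D => ν) j).map_eq]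
    have h := ProbabilityTheory.HasSubgaussianMGF.measure_sum_ge_le_of_iIndepFun
      (ProbabilityTheory.iIndepFun_pi (μ := fun _ : Fin D => ν)
        (X := fun _ x => g x - ∫ x, g x ∂ν) fun _ => (hg.sub_const _).aemeasurable)
      (s := Finset.univ) (c := fun _ => 1) (fun j _ => hsub' j) (ε := D * s) (by positivity)
    rw [← ENNReal.ofReal_toReal (measure_ne_top _ _)]
    refine ENNReal.ofReal_le_ofReal (h.trans (le_of_eq ?_))
    congr 1
    simp
    field_simp
  have h1 := key f hf hf1
  have h2 := key (fun x => -f x) hf.neg (by simpa using hf1)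
  rw [two_mul, ENNReal.ofReal_add (Real.exp_pos _).le (Real.exp_pos _).le]
  refine le_trans (measure_mono fun E hE => ?_) ((measure_union_le _ _).trans (add_le_add h1 h2))
  rcases le_abs.1 (show D * s ≤ |∑ j, (f (E j) - ∫ x, f x ∂ν)| from hE) with h | h
  · exact Or.inl h
  · right
    show D * s ≤ ∑ j, (-f (E j) - ∫ x, -f x ∂ν)
    rw [integral_neg]
    refine h.trans (le_of_eq ?_)
    rw [← Finset.sum_neg_distrib]
    exact Finset.sum_congr rfl fun j _ => by ring

/-- The transform of the normalized density of the levels `E`. -/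
noncomputable def levelTransform {D : ℕ} (E : Fin D → ℝ) (t : ℝ) : ℂ :=
  (D : ℂ)⁻¹ * ∑ j, Complex.exp (-(Complex.I * E j * t))

theorem norm_exp_neg_I_mul (x t : ℝ) : ‖Complex.exp (-(Complex.I * x * t))‖ = 1 := by
  rw [Complex.norm_exp]
  simp

theorem integrable_exp_neg_I_mul {ν : Measure ℝ} [IsProbabilityMeasure ν] (t : ℝ) :
    Integrable (fun x : ℝ => Complex.exp (-(Complex.I * x * t))) ν :=
  Integrable.of_bound (by fun_prop) 1 (ae_of_all _ fun x => (norm_exp_neg_I_mul x t).le)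

theorem norm_exp_sub_exp_le (x s t : ℝ) :
    ‖Complex.exp (-(Complex.I * x * s)) - Complex.exp (-(Complex.I * x * t))‖ ≤
      |x| * |s - t| := by
  have h : Complex.exp (-(Complex.I * x * s)) - Complex.exp (-(Complex.I * x * t)) =
      Complex.exp (-(Complex.I * x * t)) *
        (Complex.exp (Complex.I * ((-(x * (s - t)) : ℝ) : ℂ)) - 1) := by
    rw [mul_sub, mul_one, ← Complex.exp_add]
    congr 2
    push_cast
    ring
  rw [h, norm_mul, norm_exp_neg_I_mul, one_mul]
  refine (Real.norm_exp_I_mul_ofReal_sub_one_le).trans (le_of_eq ?_)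
  rw [norm_neg, norm_mul, Real.norm_eq_abs, Real.norm_eq_abs]

theorem pi_levelTransform_le {ν : Measure ℝ} [IsProbabilityMeasure ν] {D : ℕ} (hD : 0 < D)
    (t : ℝ) {s : ℝ} (hs : 0 ≤ s) :
    Measure.pi (fun _ : Fin D => ν) {E | 2 * s ≤ ‖levelTransform E t - dosTransform ν t‖} ≤
      ENNReal.ofReal (4 * Real.exp (-(D * s ^ 2 / 2))) := by
  have hD' : (0 : ℝ) < D := by exact_mod_cast hD
  have hint := integrable_exp_neg_I_mul (ν := ν) t
  have h1 := pi_hoeffding (ν := ν) (f := fun x => (Complex.exp (-(Complex.I * x * t))).re)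
    (by fun_prop) (fun x => (Complex.abs_re_le_norm _).trans (norm_exp_neg_I_mul x t).le) hD hs
  have h2 := pi_hoeffding (ν := ν) (f := fun x => (Complex.exp (-(Complex.I * x * t))).im)
    (by fun_prop) (fun x => (Complex.abs_im_le_norm _).trans (norm_exp_neg_I_mul x t).le) hD hs
  rw [show 4 * Real.exp (-(D * s ^ 2 / 2)) = 2 * Real.exp (-(D * s ^ 2 / 2)) +
    2 * Real.exp (-(D * s ^ 2 / 2)) by ring, ENNReal.ofReal_add (by positivity) (by positivity)]
  refine le_trans (measure_mono fun E hE => ?_) ((measure_union_le _ _).trans (add_le_add h1 h2))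
  by_contra hn
  simp only [Set.mem_union, Set.mem_ofPred_eq, not_or, not_le] at hn
  set z := ∑ j, (Complex.exp (-(Complex.I * E j * t)) - dosTransform ν t) with hz
  have hre : z.re = ∑ j, ((Complex.exp (-(Complex.I * E j * t))).re -
      ∫ x : ℝ, (Complex.exp (-(Complex.I * x * t))).re ∂ν) := by
    rw [hz, Complex.re_sum]
    refine Finset.sum_congr rfl fun j _ => ?_
    rw [Complex.sub_re, dosTransform]
    congr 1
    exact (integral_re hint).symm
  have him : z.im = ∑ j, ((Complex.exp (-(Complex.I * E j * t))).im -
      ∫ x : ℝ, (Complex.exp (-(Complex.I * x * t))).im ∂ν) := by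
    rw [hz, Complex.im_sum]
    refine Finset.sum_congr rfl fun j _ => ?_
    rw [Complex.sub_im, dosTransform]
    congr 1
    exact (integral_im hint).symm
  have e : levelTransform E t - dosTransform ν t = (D : ℂ)⁻¹ * z := by
    have : (D : ℂ) ≠ 0 := by exact_mod_cast hD.ne'
    rw [hz, Finset.sum_sub_distrib, mul_sub, levelTransform]
    simp
    field_simp
  have hE' : 2 * s ≤ ‖levelTransform E t - dosTransform ν t‖ := hE
  rw [e, norm_mul, norm_inv, Complex.norm_natCast, ← div_eq_inv_mul, le_div_iff₀ hD'] at hE'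
  have h3 := Complex.norm_le_abs_re_add_abs_im z
  rw [hre, him] at h3
  linarith [hn.1, hn.2]

theorem norm_levelTransform_sub_le {D : ℕ} (E : Fin D → ℝ) (s t : ℝ) :
    ‖levelTransform E s - levelTransform E t‖ ≤ (D : ℝ)⁻¹ * (∑ j, |E j|) * |s - t| := by
  rw [levelTransform, levelTransform, ← mul_sub, ← Finset.sum_sub_distrib, norm_mul, norm_inv,
    Complex.norm_natCast, mul_assoc, Finset.sum_mul]
  gcongr
  exact norm_sum_le_of_le _ fun j _ => norm_exp_sub_exp_le _ _ _

theorem norm_dosTransform_sub_le {ν : Measure ℝ} [IsProbabilityMeasure ν]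
    (hν : Integrable (fun x : ℝ => |x|) ν) (s t : ℝ) :
    ‖dosTransform ν s - dosTransform ν t‖ ≤ (∫ x, |x| ∂ν) * |s - t| := by
  rw [dosTransform, dosTransform, ← integral_sub (integrable_exp_neg_I_mul s)
    (integrable_exp_neg_I_mul t), ← integral_mul_const]
  exact norm_integral_le_of_norm_le (hν.mul_const _)
    (ae_of_all _ fun x => norm_exp_sub_exp_le _ _ _)

theorem exp_neg_I_mul_neg (x t : ℝ) : Complex.exp (-(Complex.I * x * ((-t : ℝ) : ℂ))) =
    (starRingEnd ℂ) (Complex.exp (-(Complex.I * x * t))) := by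
  rw [← Complex.exp_conj]
  congr 1
  simp

theorem norm_levelTransform_sub_dosTransform_neg {ν : Measure ℝ} {D : ℕ} (E : Fin D → ℝ) (t : ℝ) :
    ‖levelTransform E (-t) - dosTransform ν (-t)‖ = ‖levelTransform E t - dosTransform ν t‖ := by
  have h1 : levelTransform E (-t) = (starRingEnd ℂ) (levelTransform E t) := by
    simp only [levelTransform, exp_neg_I_mul_neg, map_mul, map_sum, map_inv₀, map_natCast]
  have h2 : dosTransform ν (-t) = (starRingEnd ℂ) (dosTransform ν t) := by
    simp only [dosTransform, exp_neg_I_mul_neg, integral_conj]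
  rw [h1, h2, ← map_sub, Complex.norm_conj]

theorem pi_sum_abs_le {ν : Measure ℝ} [IsProbabilityMeasure ν]
    (hν : Integrable (fun x : ℝ => |x|) ν) {D : ℕ} (hD : 0 < D) :
    Measure.pi (fun _ : Fin D => ν) {E | 4 * (1 + ∫ x, |x| ∂ν) * D ≤ ∑ j, |E j|} ≤
      ENNReal.ofReal (1 / 4) := by
  have hD' : (0 : ℝ) < D := by exact_mod_cast hD
  have hb : 0 ≤ ∫ x, |x| ∂ν := integral_nonneg fun x => abs_nonneg x
  have hi : ∀ j : Fin D, Integrable (fun E : Fin D → ℝ => |E j|) (Measure.pi fun _ => ν) :=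
    fun j => (measurePreserving_eval (fun _ : Fin D => ν) j).integrable_comp_of_integrable hν
  have h := mul_meas_ge_le_integral_of_nonneg (μ := Measure.pi fun _ : Fin D => ν)
    (f := fun E => ∑ j, |E j|) (ae_of_all _ fun E => Finset.sum_nonneg fun j _ => abs_nonneg _)
    (integrable_finsetSum _ fun j _ => hi j) (4 * (1 + ∫ x, |x| ∂ν) * D)
  have e : ∫ E : Fin D → ℝ, ∑ j, |E j| ∂(Measure.pi fun _ => ν) = D * ∫ x, |x| ∂ν := by
    rw [integral_finsetSum _ fun j _ => hi j]
    have : ∀ j : Fin D, ∫ E : Fin D → ℝ, |E j| ∂(Measure.pi fun _ => ν) = ∫ x, |x| ∂ν := fun j =>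
      integral_comp_eval (μ := fun _ : Fin D => ν) (i := j) hν.aestronglyMeasurable
    simp [this]
  rw [e] at h
  rw [← ENNReal.ofReal_toReal (measure_ne_top _ _)]
  apply ENNReal.ofReal_le_ofReal
  have hp : 0 < 4 * (1 + ∫ x, |x| ∂ν) * D := by positivity
  rw [← mul_le_mul_iff_right₀ hp]
  refine h.trans ?_
  nlinarith

/-- Independent samples of `ν` work with positive probability. The logarithm in the error pays for a
union bound over all grid times; Markov's inequality bounds `∑ |E j|`, which is the Lipschitz
constant needed between grid points. -/
theorem exists_levels {ν : Measure ℝ} [IsProbabilityMeasure ν]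
    (hν : Integrable (fun x : ℝ => |x|) ν) :
    ∃ C : ℝ, 0 < C ∧ ∀ D : ℕ, 0 < D → ∃ E : Fin D → ℝ, ∑ j, |E j| ≤ C * D ∧
      ∀ t : ℝ, ‖levelTransform E t - dosTransform ν t‖ ≤
        C * √(Real.log (D + |t| + 2) / D) := by
  set b := 1 + ∫ x, |x| ∂ν with hb
  have hb0 : 0 ≤ ∫ x, |x| ∂ν := integral_nonneg fun x => abs_nonneg x
  refine ⟨5 * b + 9, by positivity, fun D hD => ?_⟩
  have hD' : (1 : ℝ) ≤ D := by exact_mod_cast hD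
  -- The `10` makes the Hoeffding bound `4 (m + D + 2)⁻⁵`. Since `m + D + 2 ≥ 3`, it is at most `4 /
  -- (27 (m + 1)²)`, which sums to less than `1 / 4` over the infinite grid.
  let s : ℕ → ℝ := fun m => √(10 * Real.log (m + D + 2) / D)
  have hlog : ∀ m : ℕ, 0 ≤ Real.log (m + D + 2) := fun m => Real.log_nonneg (by
    have : (0 : ℝ) ≤ m := by positivity
    linarith)
  let B : ℕ → Set (Fin D → ℝ) := fun m =>
    {E | 2 * s m ≤ ‖levelTransform E (m / D) - dosTransform ν (m / D)‖}
  have hB : ∀ m, Measure.pi (fun _ : Fin D => ν) (B m) ≤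
      ENNReal.ofReal (4 / 27 * (1 / ((m + 1 : ℕ) : ℝ) ^ 2)) := by
    intro m
    refine (pi_levelTransform_le hD (m / D) (Real.sqrt_nonneg _)).trans
      (ENNReal.ofReal_le_ofReal ?_)
    have hm : (0 : ℝ) ≤ m := by positivity
    have e : -((D : ℝ) * s m ^ 2 / 2) = -(5 * Real.log (m + D + 2)) := by
      have h0 := hlog m
      simp only [s]
      rw [Real.sq_sqrt (by positivity)]
      field_simp
      ring
    rw [e, Real.exp_neg, mul_comm 5, Real.exp_mul, Real.exp_log (by linarith)]
    have h5 : ((m : ℝ) + D + 2) ^ (5 : ℝ) = ((m : ℝ) + D + 2) ^ 5 := by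
      exact Real.rpow_ofNat _ 5
    rw [h5]
    have h6 : 27 * ((m : ℝ) + 1) ^ 2 ≤ ((m : ℝ) + D + 2) ^ 5 := by
      calc 27 * ((m : ℝ) + 1) ^ 2 ≤ (m + D + 2) ^ 3 * (m + D + 2) ^ 2 := by
            gcongr ?_ * ?_ ^ 2
            · calc (27 : ℝ) = 3 ^ 3 := by norm_num
                _ ≤ _ := by
                  gcongr
                  linarith
            · linarith
        _ = _ := by ring
    calc 4 * (((m : ℝ) + D + 2) ^ 5)⁻¹ ≤ 4 * (27 * ((m : ℝ) + 1) ^ 2)⁻¹ := by gcongr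
      _ = _ := by
        push_cast
        field_simp
  have hsum : Measure.pi (fun _ : Fin D => ν) (⋃ m, B m) ≤ ENNReal.ofReal (1 / 4) := by
    have hz := (hasSum_nat_add_iff' 1).2 hasSum_zeta_two
    simp only [Finset.sum_range_one, Nat.cast_zero, ne_eq, OfNat.ofNat_ne_zero, not_false_eq_true,
      zero_pow, div_zero, sub_zero] at hz
    have hz' := hz.mul_left (4 / 27)
    calc _ ≤ ∑' m, Measure.pi (fun _ : Fin D => ν) (B m) := measure_iUnion_le _
      _ ≤ ∑' m : ℕ, ENNReal.ofReal (4 / 27 * (1 / ((m + 1 : ℕ) : ℝ) ^ 2)) :=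
          ENNReal.tsum_le_tsum hB
      _ = ENNReal.ofReal (4 / 27 * (Real.pi ^ 2 / 6)) := by
          rw [← ENNReal.ofReal_tsum_of_nonneg (fun m => by positivity) hz'.summable, hz'.tsum_eq]
      _ ≤ _ := by
          apply ENNReal.ofReal_le_ofReal
          nlinarith [Real.pi_lt_d2, Real.pi_pos]
  obtain ⟨E, hE⟩ : ∃ E, E ∉ (⋃ m, B m) ∪ {E : Fin D → ℝ | 4 * b * D ≤ ∑ j, |E j|} := by
    by_contra! h
    have h1 : Measure.pi (fun _ : Fin D => ν) Set.univ ≤ ENNReal.ofReal (1 / 4) +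
        ENNReal.ofReal (1 / 4) := by
      rw [← Set.eq_univ_of_forall h]
      exact (measure_union_le _ _).trans (add_le_add hsum (pi_sum_abs_le hν hD))
    rw [measure_univ, ← ENNReal.ofReal_add (by norm_num) (by norm_num),
      ENNReal.one_le_ofReal] at h1
    norm_num at h1
  simp only [Set.mem_union, Set.mem_iUnion, not_or, not_exists, Set.mem_ofPred_eq, not_le, B] at hE
  obtain ⟨hE1, hE2⟩ := hE
  refine ⟨E, hE2.le.trans (by gcongr; linarith), ?_⟩
  have main : ∀ t : ℝ, 0 ≤ t → ‖levelTransform E t - dosTransform ν t‖ ≤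
      (5 * b + 9) * √(Real.log (D + t + 2) / D) := by
    intro t ht
    set m := ⌊t * D⌋₊ with hm
    have hm1 : (m : ℝ) ≤ t * D := Nat.floor_le (by positivity)
    have hm2 : t * D < m + 1 := Nat.lt_floor_add_one _
    have hdist : |t - m / D| ≤ 1 / D := by
      rw [abs_le]
      have : t - m / D = (t * D - m) / D := by field_simp
      rw [this]
      constructor
      · have : (0 : ℝ) ≤ (t * D - m) / D := div_nonneg (by linarith) (by linarith)
        have : (0 : ℝ) ≤ 1 / D := by positivity
        linarith
      · gcongr
        linarith
    have h1 : ‖levelTransform E t - levelTransform E (m / D)‖ ≤ 4 * b * (1 / D) := by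
      refine (norm_levelTransform_sub_le E _ _).trans ?_
      gcongr ?_ * ?_
      rw [inv_mul_le_iff₀ (by linarith)]
      exact hE2.le.trans_eq (mul_comm _ _)
    have h2 : ‖dosTransform ν (m / D) - dosTransform ν t‖ ≤ b * (1 / D) := by
      refine (norm_dosTransform_sub_le hν _ _).trans ?_
      rw [abs_sub_comm]
      gcongr
      linarith
    have hlog1 : 1 ≤ Real.log (D + t + 2) := by
      rw [Real.le_log_iff_exp_le (by linarith)]
      linarith [Real.exp_one_lt_d9]
    set r := √(Real.log (D + t + 2) / D) with hr
    have h3 : 1 / (D : ℝ) ≤ r := by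
      apply Real.le_sqrt_of_sq_le
      rw [div_pow, one_pow]
      gcongr
      nlinarith
    -- Since `m ≤ t D`, the grid logarithm is at most twice the one at `t`, so `s m ^ 2 ≤ 20 r² ≤ (9
    -- / 2)² r²`.
    have h4 : 2 * s m ≤ 9 * r := by
      have h5 : Real.log (m + D + 2) ≤ 2 * Real.log (D + t + 2) := by
        rw [← Real.log_rpow (by linarith)]
        apply Real.log_le_log (by positivity)
        have : ((D : ℝ) + t + 2) ^ (2 : ℝ) = (D + t + 2) ^ 2 := by
          exact Real.rpow_ofNat _ 2
        rw [this]
        nlinarith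
      have h6 : s m ≤ 9 / 2 * r := by
        have := hlog m
        simp only [s]
        rw [Real.sqrt_le_left (by positivity), mul_pow, hr, Real.sq_sqrt (by positivity),
          ← mul_div_assoc]
        gcongr ?_ / _
        linarith
      linarith
    have h7 := norm_sub_le_norm_sub_add_norm_sub (levelTransform E t) (levelTransform E (m / D))
      (dosTransform ν t)
    have h8 := norm_sub_le_norm_sub_add_norm_sub (levelTransform E (m / D))
      (dosTransform ν (m / D)) (dosTransform ν t)
    have h9 := hE1 m
    have h10 : 5 * b * (1 / D) ≤ 5 * b * r := by gcongr
    linarith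
  intro t
  rcases le_total 0 t with ht | ht
  · rw [abs_of_nonneg ht]
    exact main t ht
  · rw [abs_of_nonpos ht, ← norm_levelTransform_sub_dosTransform_neg]
    exact main (-t) (by linarith)

/-! ### Diagonal Hamiltonians and their density of states -/

/-- The diagonal Hamiltonian with energy levels `E`. -/
noncomputable def levelHamiltonian {D : ℕ} (E : Fin D → ℝ) : Matrix (Fin D) (Fin D) ℂ :=
  Matrix.diagonal fun j => (E j : ℂ)

theorem isHermitian_levelHamiltonian {D : ℕ} (E : Fin D → ℝ) : (levelHamiltonian E).IsHermitian :=
  Matrix.isHermitian_diagonal_of_self_adjoint _ (by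
    ext j
    simp)

theorem evolution_levelHamiltonian {D : ℕ} (E : Fin D → ℝ) (t : ℝ) :
    evolution (levelHamiltonian E) t =
      Matrix.diagonal fun j => Complex.exp (-(Complex.I * E j * t)) := by
  rw [evolution, levelHamiltonian, ← Matrix.diagonal_smul, Matrix.exp_diagonal]
  congr 1
  ext j
  rw [Pi.coe_exp, Complex.exp_eq_exp_ℂ]
  congr 1
  simp
  ring

theorem dosTransform_densityOfStates {D : ℕ} {H : Matrix (Fin D) (Fin D) ℂ} (hH : H.IsHermitian)
    (t : ℝ) : dosTransform (densityOfStates hH) t = levelTransform hH.eigenvalues t := by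
  rw [dosTransform, densityOfStates, integral_smul_measure, integral_finsetSum_measure
    fun j _ => integrable_exp_neg_I_mul t]
  simp only [integral_dirac, levelTransform]
  simp

/-- The spectral theorem orders the eigenvalues in its own way, so they match `E` only as a
multiset, namely the roots of the characteristic polynomial. The transform is symmetric in the
levels. -/
theorem levelTransform_eigenvalues {D : ℕ} (E : Fin D → ℝ) (t : ℝ) :
    levelTransform (isHermitian_levelHamiltonian E).eigenvalues t = levelTransform E t := by
  have h1 := (isHermitian_levelHamiltonian E).roots_charpoly_eq_eigenvalues
  have h2 : (levelHamiltonian E).charpoly.roots =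
      Multiset.map (fun j => (E j : ℂ)) Finset.univ.val := by
    rw [levelHamiltonian, Matrix.charpoly_diagonal]
    have h := Polynomial.roots_multiset_prod_X_sub_C
      (Multiset.map (fun j => (E j : ℂ)) Finset.univ.val)
    rw [Multiset.map_map] at h
    exact h
  rw [h2] at h1
  have h3 := congrArg (fun s : Multiset ℂ =>
    (s.map fun z => Complex.exp (-(Complex.I * z * t))).sum) h1
  simp only [Multiset.map_map] at h3
  rw [levelTransform, levelTransform]
  congr 1
  exact h3.symm

theorem analyticOnNhd_exp_neg_I_mul (x : ℝ) :
    AnalyticOnNhd ℝ (fun t : ℝ => Complex.exp (-(Complex.I * x * t))) Set.univ := by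
  intro t _
  have h1 : AnalyticAt ℝ (fun t : ℝ => -(Complex.I * x * (t : ℂ))) t :=
    (analyticAt_const.mul (Complex.ofRealCLM.analyticAt t)).neg
  have h2 : AnalyticAt ℝ Complex.exp (-(Complex.I * x * (t : ℂ))) :=
    analyticAt_cexp.restrictScalars
  exact h2.comp_of_eq h1 rfl

theorem analyticOnNhd_evolution {D : ℕ} (E : Fin D → ℝ) (i j : Fin D) :
    AnalyticOnNhd ℝ (fun t => evolution (levelHamiltonian E) t i j) Set.univ := by
  simp only [evolution_levelHamiltonian]
  by_cases h : i = j
  · subst h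
    simpa using analyticOnNhd_exp_neg_I_mul (E i)
  · simpa [Matrix.diagonal_apply_ne _ h] using analyticOnNhd_const

theorem analyticOnNhd_levelTransform {D : ℕ} (E : Fin D → ℝ) :
    AnalyticOnNhd ℝ (levelTransform E) Set.univ := by
  unfold levelTransform
  exact analyticOnNhd_const.mul
    (Finset.analyticOnNhd_fun_sum _ fun j _ => analyticOnNhd_exp_neg_I_mul (E j))

/-! ### From fixed times to time intervals, and the asymptotic regimes -/

/-- If the transform of the levels is small throughout `[ts, T]`, most subsystems are scrambled
throughout `[ts, T]`. -/
theorem haarUnitary_not_scrambled_le {dS dE : ℕ} (hdS : 0 < dS) {η C ts T : ℝ} (hη : 0 < η)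
    (hη1 : η ≤ 1 / 4) (hdE : 1 ≤ η * dE) (hC : 0 < C) (hts : 0 ≤ ts)
    {E : Fin (dS * dE) → ℝ} (hE : ∑ j, |E j| ≤ C * ((dS * dE : ℕ) : ℝ))
    (htr : ∀ t, ts ≤ t → t ≤ T → ‖levelTransform E t‖ ^ 2 * dS ≤ η) :
    haarUnitary (dS * dE)
        {V | ¬ ∀ t, ts ≤ t → t ≤ T → IsScrambledAt (levelHamiltonian E) V t (81 * η)} ≤
      ENNReal.ofReal ((2 * C / η * ((dS * dE : ℕ) : ℝ) ^ 2 * T + 1) *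
        (10 * ((dS * dE : ℕ) : ℝ) ^ 2 * Real.exp (-(η ^ 2 * dE / 8)))) := by
  rcases lt_or_ge T ts with hT | hT
  · have : {V : Matrix.unitaryGroup (Fin (dS * dE)) ℂ | ¬ ∀ t, ts ≤ t → t ≤ T →
        IsScrambledAt (levelHamiltonian E) V t (81 * η)} = ∅ := by
      rw [Set.eq_empty_iff_forall_notMem]
      exact fun V hV => hV fun t h1 h2 => absurd (h1.trans h2) (not_le.2 hT)
    rw [this, measure_empty]
    exact zero_le
  have hdE0 : (0 : ℝ) < dE := by
    by_contra h
    nlinarith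
  have hdS0 : (0 : ℝ) < dS := by exact_mod_cast hdS
  have hDr : ((dS * dE : ℕ) : ℝ) = dS * dE := by push_cast; rfl
  have hD0 : (0 : ℝ) < ((dS * dE : ℕ) : ℝ) := by rw [hDr]; positivity
  let u : ℝ → Fin (dS * dE) → ℂ := fun t j => Complex.exp (-(Complex.I * E j * t))
  have hu : ∀ t j, ‖u t j‖ = 1 := fun t j => norm_exp_neg_I_mul _ _
  -- With this mesh the continuity error `2 dE * (C D h)` between grid points is exactly `η / dS`,
  -- which raises `80 η` to `81 η`.
  set h : ℝ := η / (2 * C * ((dS * dE : ℕ) : ℝ) ^ 2) with hh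
  have hh0 : 0 < h := by positivity
  set N := ⌊(T - ts) / h⌋₊ with hN
  have hNle : (N : ℝ) ≤ (T - ts) / h := Nat.floor_le (div_nonneg (by linarith) hh0.le)
  let B : ℕ → Set (Matrix.unitaryGroup (Fin (dS * dE)) ℂ) := fun m =>
    {V | ∃ k l, 80 * η / dS < |blockOverlap V (u (ts + m * h)) k l - (dS : ℝ)⁻¹|}
  have hB : ∀ m ∈ Finset.range (N + 1), haarUnitary (dS * dE) (B m) ≤
      10 * ((dS * dE : ℕ) : ℝ≥0∞) ^ 2 * ENNReal.ofReal (Real.exp (-(η ^ 2 * dE / 8))) := by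
    intro m hm
    have hm' : (m : ℝ) ≤ N := by exact_mod_cast Finset.mem_range_succ_iff.1 hm
    have hmT : m * h ≤ T - ts := by
      rw [← le_div_iff₀ hh0]
      exact hm'.trans hNle
    refine haarUnitary_blockOverlap_le hη hη1 hdE (hu _) ?_
    have h1 := htr (ts + m * h) (by linarith [show 0 ≤ m * h by positivity]) (by linarith)
    rw [levelTransform, norm_mul, norm_inv, Complex.norm_natCast, mul_pow, inv_pow, mul_assoc,
      inv_mul_le_iff₀ (by positivity)] at h1
    rw [mul_comm η]
    exact h1
  calc _ ≤ haarUnitary (dS * dE) (⋃ m ∈ Finset.range (N + 1), B m) := by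
        refine measure_mono fun V hV => ?_
        by_contra hn
        simp only [Set.mem_iUnion, not_exists, B, Set.mem_ofPred_eq, not_lt] at hn
        refine hV fun t ht1 ht2 k l => ?_
        rw [subsystemOverlap_eq (evolution_levelHamiltonian E t), ← Complex.ofReal_natCast,
          ← Complex.ofReal_inv, ← Complex.ofReal_sub, Complex.norm_real, Real.norm_eq_abs]
        set m := ⌊(t - ts) / h⌋₊ with hm
        have hm1 : (m : ℝ) ≤ (t - ts) / h := Nat.floor_le (div_nonneg (by linarith) hh0.le)
        have hm2 : (t - ts) / h < m + 1 := Nat.lt_floor_add_one _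
        have hmN : m ∈ Finset.range (N + 1) := by
          rw [Finset.mem_range_succ_iff]
          exact Nat.floor_le_floor (by gcongr)
        rw [le_div_iff₀ hh0] at hm1
        rw [div_lt_iff₀ hh0] at hm2
        have h1 := hn m hmN k l
        have h2 := abs_blockOverlap_sub_le V (hu t) (hu (ts + m * h)) k l
        have h3 : ∑ j, ‖u t j - u (ts + m * h) j‖ ≤ C * ((dS * dE : ℕ) : ℝ) * h := by
          calc _ ≤ ∑ j, |E j| * |t - (ts + m * h)| :=
                Finset.sum_le_sum fun j _ => norm_exp_sub_exp_le _ _ _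
            _ = (∑ j, |E j|) * |t - (ts + m * h)| := (Finset.sum_mul _ _ _).symm
            _ ≤ _ := by
                gcongr
                rw [abs_le]
                constructor <;> linarith
        have h4 : 2 * dE * (C * ((dS * dE : ℕ) : ℝ) * h) = η / dS := by
          rw [hh, hDr]
          field_simp
        have h5 : 2 * dE * ∑ j, ‖u t j - u (ts + m * h) j‖ ≤ η / dS := by
          rw [← h4]
          gcongr
        have h6 := abs_sub_le (blockOverlap V (u t) k l) (blockOverlap V (u (ts + m * h)) k l)
          (dS : ℝ)⁻¹
        calc _ ≤ η / dS + 80 * η / dS := by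
              refine h6.trans ?_
              linarith
          _ = _ := by ring
    _ ≤ ∑ _m ∈ Finset.range (N + 1),
          10 * ((dS * dE : ℕ) : ℝ≥0∞) ^ 2 * ENNReal.ofReal (Real.exp (-(η ^ 2 * dE / 8))) :=
        (measure_biUnion_finset_le _ _).trans (Finset.sum_le_sum hB)
    _ = ENNReal.ofReal ((N + 1 : ℕ) *
          (10 * ((dS * dE : ℕ) : ℝ) ^ 2 * Real.exp (-(η ^ 2 * dE / 8)))) := by
        rw [Finset.sum_const, Finset.card_range, nsmul_eq_mul, ENNReal.ofReal_mul (by positivity),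
          ENNReal.ofReal_mul (by positivity), ENNReal.ofReal_mul (by positivity),
          ENNReal.ofReal_pow (by positivity), ENNReal.ofReal_natCast, ENNReal.ofReal_natCast,
          ENNReal.ofReal_ofNat]
    _ ≤ _ := by
        apply ENNReal.ofReal_le_ofReal
        gcongr
        push_cast
        gcongr
        refine hNle.trans ?_
        calc (T - ts) / h ≤ T / h := by gcongr; linarith
          _ = _ := by
            rw [hh, hDr]
            field_simp

theorem IsScrambledAt.mono {dS dE : ℕ} {H : Matrix (Fin (dS * dE)) (Fin (dS * dE)) ℂ}
    {V : Matrix.unitaryGroup (Fin (dS * dE)) ℂ} {t δ δ' : ℝ} (h : IsScrambledAt H V t δ)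
    (hδ : δ ≤ δ') : IsScrambledAt H V t δ' := fun k l => (h k l).trans (by gcongr)

/-- Levels whose transform is Gaussian up to a random matrix error are Gaussian to leading order at
early times. -/
theorem eventually_levelTransform_sub_le {a C : ℝ} (ha : 0 < a) (hC : 0 < C)
    {E : ∀ D : ℕ, Fin D → ℝ}
    (hE : ∀ D : ℕ, 0 < D → ∀ t : ℝ, ‖levelTransform (E D) t - (Real.exp (-a * t ^ 2 / 2) : ℂ)‖ ≤
      C * √(Real.log (D + |t| + 2) / D))
    {tD : ℕ → ℝ}
    (htD : Tendsto (fun D : ℕ => Real.exp (a * tD D ^ 2) * Real.log D / D) atTop (𝓝 0))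
    {δ : ℝ} (hδ : 0 < δ) :
    ∀ᶠ D : ℕ in atTop, ∀ t : ℝ, |t| ≤ tD D →
      ‖levelTransform (E D) t - (Real.exp (-a * t ^ 2 / 2) : ℂ)‖ ≤
        δ * Real.exp (-a * t ^ 2 / 2) := by
  -- The bound `1` gives `e^{a tD²} ≤ D`, hence `|t| ≤ D` and a logarithm of at most `2 log D`; the
  -- other bound gives the accuracy `δ`.
  have h1 := htD.eventually_le_const (show 0 < min 1 (δ ^ 2 / (2 * C ^ 2)) by positivity)
  have h2 : ∀ᶠ D : ℕ in atTop, max 3 (1 / a) ≤ (D : ℝ) :=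
    tendsto_natCast_atTop_atTop.eventually_ge_atTop _
  filter_upwards [h1, h2] with D h1 h2 t ht
  obtain ⟨h1a, h1b⟩ := le_min_iff.1 h1
  obtain ⟨h2a, h2b⟩ := max_le_iff.1 h2
  have hD : (0 : ℝ) < D := by linarith
  have hlog : 1 ≤ Real.log D := by
    rw [Real.le_log_iff_exp_le hD]
    linarith [Real.exp_one_lt_d9]
  have ht0 : t ^ 2 ≤ tD D ^ 2 := sq_le_sq.2 (ht.trans (le_abs_self _))
  have h3 : Real.exp (a * tD D ^ 2) ≤ D := by
    rw [div_le_one hD] at h1a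
    exact (le_mul_of_one_le_right (Real.exp_pos _).le hlog).trans h1a
  have h4 : a * tD D ^ 2 ≤ D :=
    ((Real.le_log_iff_exp_le hD).2 h3).trans (Real.log_le_self hD.le)
  have h5 : |t| ≤ D := by
    refine abs_le_of_sq_le_sq ?_ hD.le
    have : 1 ≤ a * D := by rwa [div_le_iff₀' ha] at h2b
    nlinarith
  have h6 : Real.log (D + |t| + 2) ≤ 2 * Real.log D := by
    rw [← Real.log_rpow hD, Real.rpow_ofNat]
    exact Real.log_le_log (by positivity) (by nlinarith)
  refine (hE D (by exact_mod_cast hD) t).trans ?_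
  rw [← le_div_iff₀' hC]
  apply Real.sqrt_le_iff.2
  refine ⟨by positivity, ?_⟩
  have h7 : Real.exp (-a * t ^ 2 / 2) ^ 2 = (Real.exp (a * t ^ 2))⁻¹ := by
    rw [← Real.exp_nat_mul, ← Real.exp_neg]
    congr 1
    push_cast
    ring
  have h8 : Real.exp (a * t ^ 2) ≤ Real.exp (a * tD D ^ 2) := by gcongr
  calc Real.log (D + |t| + 2) / D ≤ 2 * Real.log D / D := by gcongr
    _ = 2 * (Real.exp (a * tD D ^ 2) * Real.log D / D) * (Real.exp (a * tD D ^ 2))⁻¹ := by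
        field_simp
    _ ≤ 2 * (δ ^ 2 / (2 * C ^ 2)) * (Real.exp (a * t ^ 2))⁻¹ := by gcongr
    _ = (δ * Real.exp (-a * t ^ 2 / 2) / C) ^ 2 := by
        rw [div_pow, mul_pow, h7]
        field_simp

/-- In the scrambling regime the transform of the levels is eventually small compared with
`1 / √dS`. -/
theorem eventually_normSq_levelTransform_mul_le {a C : ℝ} (ha : 0 < a) (hC : 0 < C)
    {E : ∀ D : ℕ, Fin D → ℝ}
    (hE : ∀ D : ℕ, 0 < D → ∀ t : ℝ, ‖levelTransform (E D) t - (Real.exp (-a * t ^ 2 / 2) : ℂ)‖ ≤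
      C * √(Real.log (D + |t| + 2) / D))
    {dS dE : ℕ → ℕ} {ts T : ℕ → ℝ} (hdE : Tendsto dE atTop atTop)
    (hD : Tendsto (fun n => Real.log ((dS n * dE n : ℕ) : ℝ) / dE n) atTop (𝓝 0))
    (hts : Tendsto (fun n => ts n / Real.sqrt (Real.log (dS n))) atTop atTop)
    (hT : Tendsto (fun n => Real.log (T n) / dE n) atTop (𝓝 0)) {η : ℝ} (hη : 0 < η) :
    ∀ᶠ n in atTop, 2 ≤ dS n ∧ 1 ≤ ts n ∧ ∀ t, ts n ≤ t → t ≤ T n →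
      ‖levelTransform (E (dS n * dE n)) t‖ ^ 2 * dS n ≤ η := by
  have hdEr : Tendsto (fun n => (dE n : ℝ)) atTop atTop :=
    tendsto_natCast_atTop_atTop.comp hdE
  have hl4 : Tendsto (fun n => Real.log 4 / (dE n : ℝ)) atTop (𝓝 0) :=
    tendsto_const_nhds.div_atTop hdEr
  have hsum : Tendsto (fun n => Real.log 4 / (dE n : ℝ) +
      Real.log ((dS n * dE n : ℕ) : ℝ) / dE n + Real.log (T n) / dE n) atTop (𝓝 0) := by
    simpa using (hl4.add hD).add hT
  have hlog2 : 1 / 4 ≤ Real.log 2 := by linarith [Real.log_two_gt_d9]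
  -- Times in the range satisfy `a t² ≥ R log dS`. The `1` cancels the factor `dS`; the rest yields
  -- `η / 4`, since `log dS ≥ log 2 ≥ 1 / 4`.
  set R : ℝ := 1 + 4 * |Real.log (4 / η)| with hR
  have e1 := hsum.eventually_le_const (show 0 < η / (4 * C ^ 2) by positivity)
  have e2 := hts.eventually_ge_atTop (max 2 √(R / a))
  have e3 := hdEr.eventually_ge_atTop 1
  filter_upwards [e1, e2, e3] with n e1 e2 e3
  obtain ⟨e2a, e2b⟩ := max_le_iff.1 e2
  -- If the root vanished, division by zero would make the quotient `0`, against its lower bound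
  -- `2`. The growth hypothesis thus forces `dS n ≥ 2` eventually.
  have hs : 0 < √(Real.log (dS n)) := by
    rcases (Real.sqrt_nonneg (Real.log (dS n))).eq_or_lt' with h | h
    · rw [h, div_zero] at e2a
      linarith
    · exact h
  have hdS : 2 ≤ dS n := by
    by_contra h
    have : dS n = 0 ∨ dS n = 1 := by omega
    rcases this with h | h <;> simp [h] at hs
  have hdSr : (2 : ℝ) ≤ dS n := by exact_mod_cast hdS
  have hdS0 : (0 : ℝ) < dS n := by linarith
  have hlogS : Real.log 2 ≤ Real.log (dS n) := Real.log_le_log (by norm_num) hdSr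
  rw [le_div_iff₀ hs] at e2a e2b
  have hts1 : 1 ≤ ts n := by
    have : 1 / 2 ≤ √(Real.log (dS n)) := Real.le_sqrt_of_sq_le (by linarith)
    linarith
  refine ⟨hdS, hts1, fun t ht1 ht2 => ?_⟩
  have hDr : ((dS n * dE n : ℕ) : ℝ) = dS n * dE n := by push_cast; rfl
  have hD1 : (1 : ℝ) ≤ ((dS n * dE n : ℕ) : ℝ) := by
    rw [hDr]
    nlinarith
  have hD0 : 0 < dS n * dE n := by exact_mod_cast (zero_lt_one.trans_le hD1)
  have hlogT : Real.log (((dS n * dE n : ℕ) : ℝ) + |t| + 2) ≤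
      Real.log 4 + Real.log ((dS n * dE n : ℕ) : ℝ) + Real.log (T n) := by
    rw [← Real.log_mul (by norm_num) (by linarith), ← Real.log_mul (by positivity) (by linarith),
      abs_of_nonneg (by linarith)]
    apply Real.log_le_log (by linarith)
    nlinarith
  have h1 : Real.log (((dS n * dE n : ℕ) : ℝ) + |t| + 2) / dE n ≤ η / (4 * C ^ 2) := by
    refine le_trans ?_ e1
    rw [← add_div, ← add_div]
    gcongr
  have h2 : (C * √(Real.log (((dS n * dE n : ℕ) : ℝ) + |t| + 2) / ((dS n * dE n : ℕ) : ℝ))) ^ 2 *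
      dS n ≤ η / 4 := by
    have hl : 0 ≤ Real.log (((dS n * dE n : ℕ) : ℝ) + |t| + 2) :=
      Real.log_nonneg (by linarith [abs_nonneg t])
    rw [mul_pow, Real.sq_sqrt (by positivity)]
    calc _ = C ^ 2 * (Real.log (((dS n * dE n : ℕ) : ℝ) + |t| + 2) / dE n) := by
          generalize Real.log (((dS n * dE n : ℕ) : ℝ) + |t| + 2) = r
          rw [hDr]
          field_simp
      _ ≤ C ^ 2 * (η / (4 * C ^ 2)) := by gcongr
      _ = _ := by field_simp
  have h3 : Real.exp (-a * t ^ 2 / 2) ^ 2 * dS n ≤ η / 4 := by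
    have hR0 : 0 < R := by positivity
    have h4 : R / a * Real.log (dS n) ≤ t ^ 2 := by
      have : (√(R / a) * √(Real.log (dS n))) ^ 2 ≤ t ^ 2 := by
        gcongr
        exact e2b.trans ht1
      rwa [mul_pow, Real.sq_sqrt (by positivity), Real.sq_sqrt (by linarith)] at this
    have h5 : R * Real.log (dS n) ≤ a * t ^ 2 := by
      rw [div_mul_eq_mul_div, div_le_iff₀ ha] at h4
      linarith
    have h6 : Real.log (4 / η) ≤ (R - 1) * Real.log (dS n) := by
      have : |Real.log (4 / η)| ≤ (R - 1) * Real.log (dS n) := by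
        have := abs_nonneg (Real.log (4 / η))
        rw [hR]
        nlinarith
      exact (le_abs_self _).trans this
    rw [← Real.exp_nat_mul, ← Real.exp_log hdS0, ← Real.exp_add,
      ← Real.le_log_iff_exp_le (by positivity)]
    rw [Real.log_div (by norm_num) hη.ne'] at h6
    rw [Real.log_div hη.ne' (by norm_num)]
    push_cast
    linarith
  have h7 := hE _ hD0 t
  have h8 : ‖levelTransform (E (dS n * dE n)) t‖ ≤ Real.exp (-a * t ^ 2 / 2) +
      C * √(Real.log (((dS n * dE n : ℕ) : ℝ) + |t| + 2) / ((dS n * dE n : ℕ) : ℝ)) := by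
    have h9 := norm_le_norm_add_norm_sub' (levelTransform (E (dS n * dE n)) t)
      (Real.exp (-a * t ^ 2 / 2) : ℂ)
    rw [Complex.norm_real, Real.norm_of_nonneg (Real.exp_pos _).le] at h9
    linarith
  set x := Real.exp (-a * t ^ 2 / 2)
  set y := C * √(Real.log (((dS n * dE n : ℕ) : ℝ) + |t| + 2) / ((dS n * dE n : ℕ) : ℝ))
  calc _ ≤ (x + y) ^ 2 * dS n := by gcongr
    _ ≤ (2 * (x ^ 2 + y ^ 2)) * dS n := by
        gcongr
        exact add_sq_le
    _ ≤ η := by linarith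

theorem tendsto_haarUnitary_scrambled {a C : ℝ} (ha : 0 < a) (hC : 0 < C)
    {E : ∀ D : ℕ, Fin D → ℝ} (hE1 : ∀ D : ℕ, 0 < D → ∑ j, |E D j| ≤ C * D)
    (hE : ∀ D : ℕ, 0 < D → ∀ t : ℝ, ‖levelTransform (E D) t - (Real.exp (-a * t ^ 2 / 2) : ℂ)‖ ≤
      C * √(Real.log (D + |t| + 2) / D))
    {dS dE : ℕ → ℕ} {ts T : ℕ → ℝ} (hdE : Tendsto dE atTop atTop)
    (hD : Tendsto (fun n => Real.log ((dS n * dE n : ℕ) : ℝ) / dE n) atTop (𝓝 0))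
    (hts : Tendsto (fun n => ts n / Real.sqrt (Real.log (dS n))) atTop atTop)
    (hT : Tendsto (fun n => Real.log (T n) / dE n) atTop (𝓝 0)) {δ : ℝ} (hδ : 0 < δ) :
    Tendsto (fun n => haarUnitary (dS n * dE n)
      {V | ∀ t : ℝ, ts n ≤ t → t ≤ T n →
        IsScrambledAt (levelHamiltonian (E (dS n * dE n))) V t δ}) atTop (𝓝 1) := by
  set η := min (1 / 4) (δ / 81) with hη
  have hη0 : 0 < η := by positivity
  have hη1 : η ≤ 1 / 4 := min_le_left _ _
  have hηδ : 81 * η ≤ δ := by linarith [min_le_right (1 / 4) (δ / 81)]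
  set K := (2 * C / η + 1) * 10 with hK
  have hdEr : Tendsto (fun n => (dE n : ℝ)) atTop atTop :=
    tendsto_natCast_atTop_atTop.comp hdE
  have hsum : Tendsto (fun n => 4 * (Real.log ((dS n * dE n : ℕ) : ℝ) / dE n) +
      Real.log (T n) / dE n) atTop (𝓝 0) := by
    simpa using (hD.const_mul 4).add hT
  have hbad : ∀ᶠ n in atTop, haarUnitary (dS n * dE n)
      {V | ¬ ∀ t : ℝ, ts n ≤ t → t ≤ T n →
        IsScrambledAt (levelHamiltonian (E (dS n * dE n))) V t (81 * η)} ≤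
      ENNReal.ofReal (K * Real.exp (-(η ^ 2 / 16 * dE n))) := by
    filter_upwards [eventually_normSq_levelTransform_mul_le ha hC hE hdE hD hts hT hη0,
      hdEr.eventually_ge_atTop (1 / η), hdEr.eventually_ge_atTop 1,
      hsum.eventually_le_const (show 0 < η ^ 2 / 16 by positivity)]
      with n ⟨h1, h2, h3⟩ h4 h5 h6
    have hdS1 : (1 : ℝ) ≤ dS n := by exact_mod_cast (by omega : 1 ≤ dS n)
    have hD1 : (1 : ℝ) ≤ ((dS n * dE n : ℕ) : ℝ) := by
      push_cast
      nlinarith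
    have hD0 : 0 < dS n * dE n := by exact_mod_cast (zero_lt_one.trans_le hD1)
    rcases lt_or_ge (T n) (ts n) with hTn | hTn
    · have : {V : Matrix.unitaryGroup (Fin (dS n * dE n)) ℂ | ¬ ∀ t : ℝ, ts n ≤ t → t ≤ T n →
          IsScrambledAt (levelHamiltonian (E (dS n * dE n))) V t (81 * η)} = ∅ := by
        rw [Set.eq_empty_iff_forall_notMem]
        exact fun V hV => hV fun t h1 h2 => absurd (h1.trans h2) (not_le.2 hTn)
      rw [this, measure_empty]
      exact zero_le
    refine (haarUnitary_not_scrambled_le (by omega) hη0 hη1 (by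
      rwa [div_le_iff₀' hη0] at h4) hC (by linarith) (hE1 _ hD0) h3).trans
      (ENNReal.ofReal_le_ofReal ?_)
    have hT1 : 1 ≤ T n := h2.trans hTn
    set r := ((dS n * dE n : ℕ) : ℝ) with hr
    -- The union bounds cost `D⁴ T = exp(o(dE))`, which uses up at most half of the decay rate `η² /
    -- 8`.
    have h7 : r ^ 4 * T n ≤ Real.exp (η ^ 2 / 16 * dE n) := by
      rw [← Real.log_le_iff_le_exp (by positivity), Real.log_mul (by positivity) (by positivity),
        Real.log_pow]
      rw [← mul_div_assoc, ← add_div, div_le_iff₀ (by linarith)] at h6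
      exact_mod_cast h6
    have h8 : 1 ≤ r ^ 2 * T n := one_le_mul_of_one_le_of_one_le (one_le_pow₀ hD1) hT1
    calc (2 * C / η * r ^ 2 * T n + 1) * (10 * r ^ 2 * Real.exp (-(η ^ 2 * dE n / 8)))
        ≤ (2 * C / η * r ^ 2 * T n + r ^ 2 * T n) *
            (10 * r ^ 2 * Real.exp (-(η ^ 2 * dE n / 8))) := by gcongr
      _ = K * (r ^ 4 * T n) * Real.exp (-(η ^ 2 * dE n / 8)) := by rw [hK]; ring
      _ ≤ K * Real.exp (η ^ 2 / 16 * dE n) * Real.exp (-(η ^ 2 * dE n / 8)) := by gcongr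
      _ = K * Real.exp (-(η ^ 2 / 16 * dE n)) := by
          rw [mul_assoc, ← Real.exp_add]
          congr 2
          ring
  have hlim : Tendsto (fun n => 1 - ENNReal.ofReal (K * Real.exp (-(η ^ 2 / 16 * dE n)))) atTop
      (𝓝 1) := by
    have h1 : Tendsto (fun n => K * Real.exp (-(η ^ 2 / 16 * dE n))) atTop (𝓝 0) := by
      have h2 := Real.tendsto_exp_neg_atTop_nhds_zero.comp
        (hdEr.const_mul_atTop (show 0 < η ^ 2 / 16 by positivity))
      simpa using h2.const_mul K
    have h3 := ENNReal.tendsto_ofReal h1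
    rw [ENNReal.ofReal_zero] at h3
    simpa using ENNReal.Tendsto.sub tendsto_const_nhds h3 (Or.inl ENNReal.one_ne_top)
  refine tendsto_of_tendsto_of_tendsto_of_le_of_le' hlim tendsto_const_nhds ?_
    (Eventually.of_forall fun n => prob_le_one)
  filter_upwards [hbad] with n hn
  rw [tsub_le_iff_right]
  set good := {V : Matrix.unitaryGroup (Fin (dS n * dE n)) ℂ | ∀ t : ℝ, ts n ≤ t → t ≤ T n →
    IsScrambledAt (levelHamiltonian (E (dS n * dE n))) V t (81 * η)} with hgood
  -- Subadditivity suffices here, so measurability of the scrambled set plays no role.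
  calc (1 : ℝ≥0∞) = haarUnitary (dS n * dE n) (good ∪ goodᶜ) := by
        rw [Set.union_compl_self, measure_univ]
    _ ≤ haarUnitary (dS n * dE n) good + haarUnitary (dS n * dE n) goodᶜ := measure_union_le _ _
    _ ≤ _ := add_le_add
        (measure_mono fun V hV t h1 h2 => (hV t h1 h2).mono hηδ) hn

theorem mainTheorem4 (a : ℝ) (ha : 0 < a) :
    -- the Gaussian is (entire) analytic
    AnalyticOnNhd ℝ (fun t : ℝ => Real.exp (-a * t ^ 2 / 2)) Set.univ ∧
    AnalyticOnNhd ℂ (fun z : ℂ => Complex.exp (-a * z ^ 2 / 2)) Set.univ ∧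
    -- its Fourier transform is a Gaussian, which is positive
    (∀ E : ℝ,
      Integrable (fun t : ℝ =>
        (Real.exp (-a * t ^ 2 / 2) : ℂ) * Complex.exp (Complex.I * E * t)) ∧
      ((2 * Real.pi : ℝ) : ℂ)⁻¹ * ∫ t : ℝ,
        (Real.exp (-a * t ^ 2 / 2) : ℂ) * Complex.exp (Complex.I * E * t) =
          (gaussianDensity a E : ℂ) ∧
      0 < gaussianDensity a E) ∧
    -- this is a probability density of states whose transform is the given Gaussian
    IsProbabilityMeasure (volume.withDensity fun E => ENNReal.ofReal (gaussianDensity a E)) ∧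
    (∀ t : ℝ, dosTransform
      (volume.withDensity fun E => ENNReal.ofReal (gaussianDensity a E)) t =
        (Real.exp (-a * t ^ 2 / 2) : ℂ)) ∧
    -- there is a family of quantum systems, one in every dimension `D`, ...
    ∃ (H : ∀ D : ℕ, Matrix (Fin D) (Fin D) ℂ) (hH : ∀ D : ℕ, (H D).IsHermitian),
      -- ... with analytic dynamics, ...
      (∀ D : ℕ, (∀ i j, AnalyticOnNhd ℝ (fun t => evolution (H D) t i j) Set.univ) ∧
        AnalyticOnNhd ℝ (dosTransform (densityOfStates (hH D))) Set.univ) ∧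
      -- ... whose transformed density of states is the given Gaussian in the limit `D → ∞`, to
      -- leading order and uniformly over early times `|t| ≤ tD`, ...
      (∀ tD : ℕ → ℝ,
        Tendsto (fun D : ℕ => Real.exp (a * tD D ^ 2) * Real.log D / D) atTop (𝓝 0) →
        ∀ δ : ℝ, 0 < δ → ∀ᶠ D : ℕ in atTop, ∀ t : ℝ, |t| ≤ tD D →
          ‖dosTransform (densityOfStates (hH D)) t - (Real.exp (-a * t ^ 2 / 2) : ℂ)‖ ≤
            δ * Real.exp (-a * t ^ 2 / 2)) ∧
      -- ... and in which, for all dimensions `dS n` of the subsystem and `dE n` of the rest, all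
      -- `ts = ω(√(log dS))` and all `T = exp(o(dE))`, Haar-almost all subsystems are scrambled
      -- throughout `[ts, T]`.
      ∀ (dS dE : ℕ → ℕ) (ts T : ℕ → ℝ),
        Tendsto dE atTop atTop →
        Tendsto (fun n => Real.log ((dS n * dE n : ℕ) : ℝ) / dE n) atTop (𝓝 0) →
        Tendsto (fun n => ts n / Real.sqrt (Real.log (dS n))) atTop atTop →
        Tendsto (fun n => Real.log (T n) / dE n) atTop (𝓝 0) →
        ∀ δ : ℝ, 0 < δ →
          Tendsto (fun n => haarUnitary (dS n * dE n)
            {V | ∀ t : ℝ, ts n ≤ t → t ≤ T n → IsScrambledAt (H (dS n * dE n)) V t δ})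
            atTop (𝓝 1) := by
  have hprob : IsProbabilityMeasure
      (volume.withDensity fun E => ENNReal.ofReal (gaussianDensity a E)) := by
    rw [withDensity_gaussianDensity ha]
    infer_instance
  have htrans : ∀ t : ℝ, dosTransform
      (volume.withDensity fun E => ENNReal.ofReal (gaussianDensity a E)) t =
        (Real.exp (-a * t ^ 2 / 2) : ℂ) := by
    rw [withDensity_gaussianDensity ha]
    exact dosTransform_gaussianReal ha.le
  refine ⟨analyticOnNhd_gaussian a, analyticOnNhd_cexp_gaussian a, fun E =>
    ⟨integrable_gaussian_mul_cexp ha E, gaussian_fourierIntegral ha E, gaussianDensity_pos ha E⟩,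
    hprob, htrans, ?_⟩
  have hint : Integrable (fun x : ℝ => |x|)
      (volume.withDensity fun E => ENNReal.ofReal (gaussianDensity a E)) := by
    rw [withDensity_gaussianDensity ha]
    exact ((ProbabilityTheory.memLp_id_gaussianReal 1).integrable le_rfl).abs
  obtain ⟨C, hC, hlevels⟩ := exists_levels hint
  simp only [htrans] at hlevels
  have hlevels' : ∀ D : ℕ, ∃ E : Fin D → ℝ, 0 < D → ∑ j, |E j| ≤ C * D ∧
      ∀ t : ℝ, ‖levelTransform E t - (Real.exp (-a * t ^ 2 / 2) : ℂ)‖ ≤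
        C * √(Real.log (D + |t| + 2) / D) := by
    intro D
    rcases Nat.eq_zero_or_pos D with h | h
    · exact ⟨0, fun h' => absurd h h'.ne'⟩
    · obtain ⟨E, hE⟩ := hlevels D h
      exact ⟨E, fun _ => hE⟩
  choose E hE using hlevels'
  have hdos : ∀ D, dosTransform (densityOfStates (isHermitian_levelHamiltonian (E D))) =
      levelTransform (E D) := fun D => by
    ext t
    rw [dosTransform_densityOfStates, levelTransform_eigenvalues]
  refine ⟨fun D => levelHamiltonian (E D), fun D => isHermitian_levelHamiltonian (E D),
    fun D => ⟨analyticOnNhd_evolution (E D), ?_⟩, fun tD htD δ hδ => ?_,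
    fun dS dE ts T hdE hD hts hT δ hδ => tendsto_haarUnitary_scrambled ha hC
      (fun D hD => (hE D hD).1) (fun D hD => (hE D hD).2) hdE hD hts hT hδ⟩
  · rw [hdos]
    exact analyticOnNhd_levelTransform (E D)
  · simp only [hdos]
    exact eventually_levelTransform_sub_le ha hC (fun D hD => (hE D hD).2) htD hδ
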